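/- A curve is a smooth projective irreducible algebraic curve over $\mathbb{C}$, and a covering of curves is a finite surjective (possibly branched) morphism $\pi\colon X\to Y$ over $\mathbb{C}$; its degree is $d=[\mathbb{C}(X):\mathbb{C}(Y)]$. The covering is primitive if it does not factor nontrivially, i.e. whenever $\pi=g\circ f$ with morphisms $f\colon X\to Z$, $g\colon Z\to Y$ of curves, $f$ or $g$ is an isomorphism. It is solvable if its Galois group, that is, the Galois group of the normal closure of $\mathbb{C}(X)/\mathbb{C}(Y)$, is solvable. For $x\in X$ let $e_x$ be the ramification index of $\pi$ at $x$; a (closed) point $y\in Y$ is a branch point if $e_x>1$ for some $x\in\pi^{-1}(y)$, and $b(y)=\sum_{x\in\pi^{-1}(y)}(e_x-1)$ denotes its multiplicity in the branch divisor. **Proposition.** Let $\pi\colon X\to Y$ be a primitive solvable covering of curves of degree $d$. Then there are a prime $p$ and an integer $k\ge 0$ such that $d=p^k$ (so $k\ge 1$ unless $d=1$, in which case there are no branch points), and every branch point $y\in Y$ of $\pi$ satisfies $$b(y)\ \ge\ \frac{p^k-p^{k-1}}{2}.$$ If moreover $p=2$ and $d-1$ is prime (hence a Mersenne prime), then every branch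 point $y$ of $\pi$ satisfies $$b(y)\ \ge\ 2^{k-1}-1 .$$ -/

import Mathlib

open CategoryTheory AlgebraicGeometry

namespace CurveCovering

/-- A (smooth projective algebraic) curve over `ℂ`: an integral scheme of dimension one, smooth
and proper over `Spec ℂ`. (A proper curve over a field is projective.) -/
class IsCurve (X : Over (Spec (CommRingCat.of ℂ))) : Prop where
  isIntegral : IsIntegral X.left
  smooth : Smooth X.hom
  isProper : IsProper X.hom
  dim_eq_one : topologicalKrullDim X.left = 1

attribute [instance] IsCurve.isIntegral IsCurve.smooth IsCurve.isProper

/-- A (possibly branched) covering of curves: a finite surjective morphism over `ℂ`. -/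
class IsCovering {X Y : Over (Spec (CommRingCat.of ℂ))} (π : X ⟶ Y) : Prop where
  isFinite : IsFinite π.left
  surjective : Surjective π.left

attribute [instance] IsCovering.isFinite IsCovering.surjective

/-- A surjective morphism of integral schemes maps the generic point to the generic point. -/
theorem map_genericPoint {X Y : Scheme} [IsIntegral X] [IsIntegral Y] (f : X ⟶ Y) [Surjective f] :
    f (genericPoint X) = genericPoint Y := by
  have h := (genericPoint_spec X).image f.continuous
  rw [Set.image_univ, f.surjective.range_eq, closure_univ] at h
  exact h.eq (genericPoint_spec Y)

section Covering

variable {X Y : Over (Spec (CommRingCat.of ℂ))} [IsCurve X] [IsCurve Y] (π : X ⟶ Y) [IsCovering π]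

/-- The pullback of rational functions `K(Y) → K(X)`: the map of stalks at the generic points. -/
noncomputable def functionFieldMap : Y.left.functionField ⟶ X.left.functionField :=
  Y.left.presheaf.stalkSpecializes (specializes_of_eq (map_genericPoint π.left)) ≫
    π.left.stalkMap (genericPoint X.left)

/-- `K(X)` as an extension field of `K(Y)`. -/
noncomputable abbrev functionFieldAlgebra : Algebra Y.left.functionField X.left.functionField :=
  (functionFieldMap π).hom.toAlgebra

/-- The degree of a covering: `[K(X) : K(Y)]`. -/
noncomputable def degree : ℕ :=
  letI := functionFieldAlgebra π
  Module.finrank Y.left.functionField X.left.functionField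

/-- The field of rational functions of the Galois closure of a covering: the normal closure of
`K(X)` over `K(Y)`. -/
noncomputable def galoisClosure :
    letI := functionFieldAlgebra π
    IntermediateField Y.left.functionField (AlgebraicClosure X.left.functionField) :=
  letI := functionFieldAlgebra π
  IntermediateField.normalClosure Y.left.functionField X.left.functionField
    (AlgebraicClosure X.left.functionField)

/-- A covering is solvable if its Galois group, that is, the Galois group over `K(Y)` of the normal
closure of `K(X)`, is solvable. -/
def IsSolvableCovering : Prop :=
  letI := functionFieldAlgebra π
  Group.IsSolvable (galoisClosure π ≃ₐ[Y.left.functionField] galoisClosure π)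

/-- A covering is primitive if it does not factor nontrivially: whenever it is a composite of two
morphisms of curves, one of them is an isomorphism. -/
def IsPrimitive : Prop :=
  ∀ (Z : Over (Spec (CommRingCat.of ℂ))) [IsCurve Z] (f : X ⟶ Z) (g : Z ⟶ Y),
    f ≫ g = π → IsIso f ∨ IsIso g

/-- The ramification index of `π` at a point `x` of `X`, which is the multiplicity of `x` in the
fibre of `π` through `x`. -/
noncomputable def ramificationIndex (x : X.left) : ℕ :=
  letI := (π.left.stalkMap x).hom.toAlgebra
  (IsLocalRing.maximalIdeal (X.left.presheaf.stalk x)).ramificationIdx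
    (Y.left.presheaf.stalk (π.left x))

/-- A branch point of a covering: a closed point of `Y` over which `π` ramifies. -/
def IsBranchPoint (y : Y.left) : Prop :=
  IsClosed {y} ∧ ∃ x : X.left, π.left x = y ∧ 1 < ramificationIndex π x

/-- The multiplicity of `y` in the branch divisor, the push-forward by `π` of the ramification
divisor `∑ (e_x - 1) x`. -/
noncomputable def branchMultiplicity (y : Y.left) : ℕ :=
  ∑ᶠ x : {x : X.left // π.left x = y}, (ramificationIndex π x.1 - 1)

end Covering

end CurveCovering

/-! Let `N` be the Galois closure of `K(X)/K(Y)`, `G` its Galois group and `H` the subgroup fixing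
`K(X)`. For an intermediate field, the normalization of `Y` in it is a curve through which `π`
factors. Hence primitivity leaves only trivial intermediate fields (`IsPrimitive.eq_bot_or_eq_top`),
and if `d > 1` then `H` is a maximal subgroup with trivial core. Since `G` is solvable, it then has
a nontrivial abelian normal subgroup of prime exponent `p`, the translations. It complements `H`, so
`d` is its order `p ^ k`. If `g ≠ 1` fixes a point of `G ⧸ H`, its fixed points inject into the
translations commuting with it. These form a proper subgroup, because `H` acts faithfully on
translations; so at most `p ^ (k - 1)` points are fixed. Every orbit of a subgroup containing `g` is
a fixed point of `g` or has at least two elements, so there are at most `(p ^ k + p ^ (k - 1)) / 2`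
orbits (`Group.IsSolvable.exists_index_eq_prime_pow_and_card_orbits_le`). The points over `y` are
the orbits on `G ⧸ H` of a decomposition group `D`
(`Algebra.IsInvariant.card_primesOver_eq_card_orbits`). Residue fields are `ℂ`, so the ramification
indices over `y` sum to `d` and `b(y)` is `d` minus the number of orbits. Ramification makes `D`
nontrivial, and the first bound follows. If `p = 2` and `2 ^ k - 1` is prime, a nontrivial element
of `H` fixes at most two translations (`MulDistribMulAction.card_fixed_le_two_of_mersenne`): an
abelian normal subgroup of `H` is regular on nonzero vectors, and an element fixing two of them
centralizes it. With `2` in place of `p ^ (k - 1)` the same count gives the second bound. -/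

/-! ### Solvable groups and counting orbits. -/

/-- Every nontrivial finite solvable group has a nontrivial normal subgroup which is commutative
of prime exponent. -/
theorem Group.IsSolvable.exists_normal_commutative_exponent_prime (G : Type*) [Group G] [Finite G]
    [Group.IsSolvable G] [Nontrivial G] :
    ∃ (N : Subgroup G) (p : ℕ), p.Prime ∧ N.Normal ∧ N ≠ ⊥ ∧ (∀ a ∈ N, ∀ b ∈ N, a * b = b * a) ∧
      ∀ a ∈ N, a ^ p = 1 := by
  classical
  have hex : ∃ n, derivedSeries G n = ⊥ := Group.IsSolvable.solvable
  obtain ⟨n, hn⟩ : ∃ n, Nat.find hex = n + 1 := by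
    refine Nat.exists_eq_succ_of_ne_zero fun h => ?_
    have := Nat.find_spec hex
    rw [h, derivedSeries_zero] at this
    exact top_ne_bot this
  -- The last nontrivial term of the derived series is abelian; its `p`-torsion, for a prime `p`
  -- dividing its order, will be the subgroup sought.
  set A := derivedSeries G n with hA
  have hA0 : A ≠ ⊥ := Nat.find_min hex (by omega)
  have hcomm : ∀ a ∈ A, ∀ b ∈ A, a * b = b * a := by
    intro a ha b hb
    have h := Nat.find_spec hex
    rw [hn, derivedSeries_succ] at h
    have := Subgroup.commutator_mem_commutator ha hb
    rw [h, Subgroup.mem_bot] at this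
    exact commutatorElement_eq_one_iff_mul_comm.mp this
  have hAn : A.Normal := derivedSeries_normal G n
  have hcard : Nat.card A ≠ 1 := fun h => hA0 ((Subgroup.card_eq_one).mp h)
  obtain ⟨p, hp, hpA⟩ := Nat.exists_prime_and_dvd hcard
  have := Fact.mk hp
  obtain ⟨x, hx⟩ := exists_prime_orderOf_dvd_card' (G := A) p hpA
  refine ⟨{ carrier := {a | a ∈ A ∧ a ^ p = 1}
            mul_mem' := ?_
            one_mem' := ⟨A.one_mem, one_pow p⟩
            inv_mem' := ?_ }, p, hp, ⟨?_⟩, ?_, ?_, ?_⟩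
  · rintro a b ⟨ha, ha'⟩ ⟨hb, hb'⟩
    refine ⟨A.mul_mem ha hb, ?_⟩
    rw [(show Commute a b from hcomm a ha b hb).mul_pow, ha', hb', one_mul]
  · rintro a ⟨ha, ha'⟩
    exact ⟨A.inv_mem ha, by rw [inv_pow, ha', inv_one]⟩
  · rintro a ⟨ha, ha'⟩ g
    exact ⟨hAn.conj_mem a ha g, by rw [conj_pow, ha']; simp⟩
  · intro h
    have hx1 : (x : G) ∈ (⊥ : Subgroup G) := by
      rw [← h]
      exact ⟨x.2, by rw [← Subgroup.coe_pow, ← hx, pow_orderOf_eq_one]; rfl⟩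
    rw [Subgroup.mem_bot, OneMemClass.coe_eq_one] at hx1
    rw [hx1, orderOf_one] at hx
    exact hp.one_lt.ne hx
  · exact fun a ha b hb => hcomm a ha.1 b hb.1
  · exact fun a ha => ha.2

/-- An orbit of a group is either a fixed point or has at least two elements. -/
theorem MulAction.two_mul_card_orbits_le {G X : Type*} [Group G] [MulAction G X] [Finite X]
    (g : G) :
    2 * Nat.card (MulAction.orbitRel.Quotient G X) ≤
      Nat.card X + Nat.card (MulAction.fixedBy X g) := by
  classical
  have := Fintype.ofFinite X
  have := Fintype.ofFinite (MulAction.orbitRel.Quotient G X)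
  let f : X → MulAction.orbitRel.Quotient G X := Quotient.mk''
  have hf : ∀ (h : G) x, f (h • x) = f x := fun h x =>
    Quotient.sound' (MulAction.mem_orbit x h)
  have h1 : Nat.card X = ∑ o : MulAction.orbitRel.Quotient G X,
      (Finset.univ.filter fun x => f x = o).card := by
    rw [Nat.card_eq_fintype_card, ← Finset.card_univ]
    exact Finset.card_eq_sum_card_fiberwise fun _ _ => Finset.mem_univ _
  have h2 : Nat.card (MulAction.fixedBy X g) = ∑ o : MulAction.orbitRel.Quotient G X,
      ((Finset.univ.filter fun x => g • x = x).filter fun x => f x = o).card := by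
    rw [Nat.card_eq_fintype_card, Fintype.card_subtype]
    exact Finset.card_eq_sum_card_fiberwise fun _ _ => Finset.mem_univ _
  rw [h1, h2, ← Finset.sum_add_distrib, Nat.card_eq_fintype_card, ← Finset.card_univ, mul_comm,
    ← smul_eq_mul]
  refine Finset.card_nsmul_le_sum _ _ _ fun o _ => ?_
  obtain ⟨x, rfl⟩ := Quotient.exists_rep o
  by_cases hx : g • x = x
  · have a1 : 0 < (Finset.univ.filter fun z => f z = f x).card :=
      Finset.card_pos.mpr ⟨x, by simp⟩
    have a2 : 0 < ((Finset.univ.filter fun z => g • z = z).filter fun z => f z = f x).card :=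
      Finset.card_pos.mpr ⟨x, by simp [hx]⟩
    exact Nat.add_le_add a1 a2
  · have a1 : 1 < (Finset.univ.filter fun z => f z = f x).card :=
      Finset.one_lt_card.mpr ⟨g • x, by simp [hf], x, by simp, hx⟩
    exact le_add_right a1

/-! ### Regular normal subgroups of primitive groups. -/

section Affine

variable {G : Type*} [Group G] {H N : Subgroup G}

theorem Subgroup.normal_of_normalized_of_sup_eq_top {M : Subgroup G} (hsup : N ⊔ H = ⊤)
    (hN : ∀ n ∈ N, ∀ m ∈ M, n * m * n⁻¹ ∈ M) (hH : ∀ h ∈ H, ∀ m ∈ M, h * m * h⁻¹ ∈ M) :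
    M.Normal := by
  rw [← Subgroup.normalizer_eq_top_iff, eq_top_iff, ← hsup, sup_le_iff]
  have key : ∀ K : Subgroup G, (∀ n ∈ K, ∀ m ∈ M, n * m * n⁻¹ ∈ M) →
      K ≤ Subgroup.normalizer (M : Set G) := by
    intro K hK n hn
    rw [Subgroup.mem_normalizer_iff]
    refine fun m => ⟨fun hm => hK n hn m hm, fun hm => ?_⟩
    have := hK n⁻¹ (K.inv_mem hn) _ hm
    simpa [mul_assoc] using this
  exact ⟨key N hN, key H hH⟩

/-- In a primitive permutation group, a nontrivial commutative normal subgroup is a complement of a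
point stabilizer. -/
theorem Subgroup.isComplement'_of_commutative_of_isCoatom [N.Normal] (hN : N ≠ ⊥)
    (hcomm : ∀ a ∈ N, ∀ b ∈ N, a * b = b * a) (hH : IsCoatom H)
    (hcore : ∀ M : Subgroup G, M.Normal → M ≤ H → M = ⊥) : N.IsComplement' H := by
  have hsup : N ⊔ H = ⊤ := by
    refine hH.2 _ (lt_of_le_of_ne le_sup_right fun h => ?_)
    exact hN (hcore N inferInstance (h ▸ le_sup_left))
  have hinf : N ⊓ H = ⊥ := by
    refine hcore _ (Subgroup.normal_of_normalized_of_sup_eq_top hsup ?_ ?_) inf_le_right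
    · rintro n hn m ⟨hm, hm'⟩
      rw [hcomm n hn m hm, mul_inv_cancel_right]
      exact ⟨hm, hm'⟩
    · rintro h hh m ⟨hm, hm'⟩
      exact ⟨‹N.Normal›.conj_mem m hm h, H.mul_mem (H.mul_mem hh hm') (H.inv_mem hh)⟩
  exact Subgroup.isComplement'_of_disjoint_and_mul_eq_univ (disjoint_iff.mpr hinf)
    (by rw [← Subgroup.normal_mul, hsup, Subgroup.coe_top])

/-- In a primitive affine group, the points fixed by `g` inject into the centralizer of `g` in the
translation subgroup. -/
theorem Subgroup.card_fixedBy_quotient_le [Finite G] [N.Normal] (hc : N.IsComplement' H) (g x : G)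
    (hx : g • (x : G ⧸ H) = x) :
    Nat.card (MulAction.fixedBy (G ⧸ H) g) ≤
      Nat.card (N ⊓ Subgroup.centralizer {g} : Subgroup G) := by
  let f : (N ⊓ Subgroup.centralizer {g} : Subgroup G) → G ⧸ H := fun n => ((n * x : G) : G ⧸ H)
  have hsub : MulAction.fixedBy (G ⧸ H) g ⊆ Set.range f := by
    intro y
    obtain ⟨y, rfl⟩ := QuotientGroup.mk_surjective y
    intro hy
    obtain ⟨n₀, hn₀, h, hh, hnh⟩ : ∃ n₀ ∈ N, ∃ h ∈ H, n₀ * h = x⁻¹ * y := by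
      have : x⁻¹ * y ∈ ((N ⊔ H : Subgroup G) : Set G) := by rw [hc.sup_eq_top]; trivial
      rw [Subgroup.normal_mul] at this
      obtain ⟨a, ha, b, hb, hab⟩ := Set.mem_mul.mp this
      exact ⟨a, ha, b, hb, hab⟩
    set n := x * n₀ * x⁻¹ with hn
    have hnN : n ∈ N := ‹N.Normal›.conj_mem _ hn₀ x
    have hy' : (y : G ⧸ H) = ((n * x : G) : G ⧸ H) := by
      rw [QuotientGroup.eq]
      have : y = x * n₀ * h := by rw [mul_assoc, hnh, mul_inv_cancel_left]
      rw [this, hn]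
      simpa [mul_assoc] using hh
    refine ⟨⟨n, hnN, ?_⟩, hy'.symm⟩
    change n ∈ Subgroup.centralizer {g}
    rw [Subgroup.mem_centralizer_singleton_iff]
    -- As `g` fixes the base point `xH`, it sends `nxH` to `gng⁻¹xH`; regularity of `N` then turns a
    -- fixed coset into `gng⁻¹ = n`.
    have h1 : ((g * n * g⁻¹ * x : G) : G ⧸ H) = ((n * x : G) : G ⧸ H) := by
      have e1 : ((n * x : G) : G ⧸ H) = ((g * n * g⁻¹ : G) • (g • (x : G ⧸ H))) := by
        rw [MulAction.Quotient.smul_coe, MulAction.Quotient.smul_coe, smul_eq_mul, smul_eq_mul]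
        rw [hy'] at hy
        have hy2 : g • ((n * x : G) : G ⧸ H) = ((n * x : G) : G ⧸ H) := hy
        rw [MulAction.Quotient.smul_coe, smul_eq_mul] at hy2
        rw [← hy2]
        congr 1
        group
      rw [e1, hx, MulAction.Quotient.smul_coe, smul_eq_mul]
    rw [QuotientGroup.eq] at h1
    have h2 : x⁻¹ * ((g * n * g⁻¹)⁻¹ * n) * x⁻¹⁻¹ ∈ N := by
      refine ‹N.Normal›.conj_mem _ (N.mul_mem (N.inv_mem ?_) hnN) _
      exact ‹N.Normal›.conj_mem _ hnN g
    have h3 : x⁻¹ * ((g * n * g⁻¹)⁻¹ * n) * x⁻¹⁻¹ = 1 := by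
      refine Subgroup.disjoint_def.mp hc.disjoint h2 ?_
      convert h1 using 1
      group
    have h4 : (g * n * g⁻¹)⁻¹ * n = 1 := by
      have : (g * n * g⁻¹)⁻¹ * n = x * (x⁻¹ * ((g * n * g⁻¹)⁻¹ * n) * x⁻¹⁻¹) * x⁻¹ := by group
      rw [this, h3]; group
    have h5 : g * n * g⁻¹ = n := (inv_mul_eq_one.mp h4)
    rw [mul_inv_eq_iff_eq_mul] at h5
    first | exact h5 | exact h5.symm
  have hfin : (Set.range f).Finite := Set.finite_range f
  calc Nat.card (MulAction.fixedBy (G ⧸ H) g) ≤ Nat.card (Set.range f) :=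
        Nat.card_mono hfin hsub
    _ ≤ _ := Finite.card_range_le f

end Affine

/-! ### Irreducible solvable linear groups and Mersenne primes. -/

section Irreducible

open scoped Pointwise

/-- Clifford's theorem, in the form: the order of a group on which `H` acts irreducibly is a power
of the order of a minimal subgroup invariant under a normal subgroup of `H`. -/
theorem MulDistribMulAction.exists_card_eq_pow_of_irreducible {V H : Type*} [CommGroup V]
    [Finite V] [Group H] [MulDistribMulAction H V]
    (hirr : ∀ M : Subgroup V, (∀ h : H, ∀ v ∈ M, h • v ∈ M) → M = ⊥ ∨ M = ⊤)
    (A : Subgroup H) [A.Normal] (W : Subgroup V) (hW : W ≠ ⊥)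
    (hmin : ∀ M : Subgroup V, M ≤ W → (∀ a ∈ A, ∀ v ∈ M, a • v ∈ M) → M = ⊥ ∨ M = W)
    (hWA : ∀ a ∈ A, ∀ v ∈ W, a • v ∈ W) :
    ∃ m, Nat.card V = Nat.card W ^ m := by
  classical
  let P : Set (Subgroup V) :=
    {S | (∀ a ∈ A, ∀ v ∈ S, a • v ∈ S) ∧ ∃ m, Nat.card S = Nat.card W ^ m}
  have hP : P.Nonempty := ⟨⊥, by
    rintro a - v hv
    rw [Subgroup.mem_bot] at hv ⊢
    rw [hv, smul_one], 0, by simp⟩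
  obtain ⟨S, hS⟩ := (Set.toFinite P).exists_maximal hP
  obtain ⟨⟨hSA, m, hm⟩, hmax⟩ := hS
  suffices S = ⊤ from ⟨m, by rw [← hm, this, Subgroup.card_top]⟩
  by_contra hS
  -- Otherwise the vectors whose `H`-translates all lie in `S` form an `H`-invariant subgroup
  -- containing `W`, and irreducibility gives `S = ⊤`.
  have hex : ∃ h : H, ¬ (h • W ≤ S) := by
    by_contra! hall
    let M : Subgroup V :=
      { carrier := {v | ∀ h : H, h • v ∈ S}
        mul_mem' := fun {a b} ha hb h => by rw [smul_mul']; exact S.mul_mem (ha h) (hb h)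
        one_mem' := fun h => by rw [smul_one]; exact S.one_mem
        inv_mem' := fun {a} ha h => by rw [smul_inv']; exact S.inv_mem (ha h) }
    have hWM : W ≤ M := fun w hw h => hall h (Subgroup.smul_mem_pointwise_smul w h W hw)
    rcases hirr M (fun h v hv k => by rw [smul_smul]; exact hv _) with h | h
    · exact hW (le_bot_iff.mp (h ▸ hWM))
    · refine hS (eq_top_iff.mpr fun v _ => ?_)
      have : v ∈ M := h ▸ Subgroup.mem_top v
      simpa using this 1
  obtain ⟨h, hh⟩ := hex
  have hconj : ∀ a ∈ A, h⁻¹ * a * h ∈ A := fun a ha => by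
    simpa using ‹A.Normal›.conj_mem a ha h⁻¹
  -- Normality of `A` makes the translate `h • W` minimal `A`-invariant as well. It meets `S`
  -- trivially, so the join multiplies the order by that of `W`, against maximality of `S`.
  have hinf : S ⊓ h • W = ⊥ := by
    have hM := hmin (h⁻¹ • S ⊓ W) inf_le_right ?_
    · rcases hM with hM | hM
      · rw [← smul_inv_smul h S, ← Subgroup.smul_inf, hM, Subgroup.smul_bot]
      · exfalso
        apply hh
        rw [inf_eq_right] at hM
        exact Subgroup.pointwise_smul_subset_iff.mpr hM
    · rintro a ha v ⟨hv, hv'⟩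
      refine ⟨?_, hWA a ha v hv'⟩
      have hv2 := Subgroup.mem_inv_pointwise_smul_iff.mp hv
      refine Subgroup.mem_inv_pointwise_smul_iff.mpr ?_
      have := hSA _ (‹A.Normal›.conj_mem a ha h) _ hv2
      simpa [smul_smul] using this
  have hcard : Nat.card (S ⊔ h • W : Subgroup V) = Nat.card W ^ (m + 1) := by
    have h1 := Subgroup.relIndex_mul_relIndex ⊥ (h • W) (S ⊔ h • W) bot_le le_sup_right
    rw [Subgroup.relIndex_sup_right, ← Subgroup.inf_relIndex_right (h • W) S,
      inf_comm (h • W) S, hinf,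
      Subgroup.relIndex_bot_left, Subgroup.relIndex_bot_left, Subgroup.relIndex_bot_left, hm,
      Nat.card_congr (Subgroup.equivSMul h W).symm.toEquiv] at h1
    rw [← h1, pow_succ, mul_comm]
  have hmem : (S ⊔ h • W) ∈ P := by
    refine ⟨fun a ha v hv => ?_, m + 1, hcard⟩
    obtain ⟨s, hs, w, hw, rfl⟩ := Subgroup.mem_sup.mp hv
    rw [smul_mul']
    refine Subgroup.mul_mem_sup (hSA a ha s hs) ?_
    obtain ⟨w, hw, rfl⟩ := hw
    have := Subgroup.smul_mem_pointwise_smul _ h W (hWA _ (hconj a ha) w hw)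
    simpa [smul_smul, mul_assoc] using this
  exact hh (le_sup_right.trans (hmax hmem le_sup_left))

/-- In a solvable irreducible linear group over `𝔽₂` whose space has `q + 1` elements with `q` a
Mersenne prime, a nontrivial element fixes at most two vectors. -/
theorem MulDistribMulAction.card_fixed_le_two_of_mersenne {V H : Type*} [CommGroup V]
    [Group H] [Finite H] [MulDistribMulAction H V] [FaithfulSMul H V] [Group.IsSolvable H]
    (hirr : ∀ M : Subgroup V, (∀ h : H, ∀ v ∈ M, h • v ∈ M) → M = ⊥ ∨ M = ⊤)
    {k : ℕ} (hV : Nat.card V = 2 ^ k) (hq : (2 ^ k - 1).Prime) (g : H) (hg : g ≠ 1) :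
    Nat.card (MulAction.fixedBy V g) ≤ 2 := by
  classical
  have : Finite V := Nat.finite_of_card_ne_zero (by rw [hV]; positivity)
  have : Nontrivial H := ⟨g, 1, hg⟩
  have hk1 : k ≠ 1 := by
    rintro rfl
    exact Nat.not_prime_one hq
  have hk : k.Prime := (Nat.prime_of_pow_sub_one_prime hk1 hq).2
  obtain ⟨A, r, hr, hAn, hA, hcomm, hexp⟩ :=
    Group.IsSolvable.exists_normal_commutative_exponent_prime H
  have hfaith : ∀ h : H, (∀ v : V, h • v = v) → h = 1 := fun h hh =>
    FaithfulSMul.eq_of_smul_eq_smul (α := V) fun v => by rw [hh, one_smul]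
  obtain ⟨a₀, ha₀, ha₀1⟩ := A.bot_or_exists_ne_one.resolve_left hA
  have hne : ∀ (h : H) (v : V), v ≠ 1 → h • v ≠ 1 := fun h v hv h1 =>
    hv (by rw [← inv_smul_smul h v, h1, smul_one])
  -- the fixed vectors of a set of elements
  let F (B : Set H) : Subgroup V :=
    { carrier := {v | ∀ a ∈ B, a • v = v}
      mul_mem' := fun {x y} hx hy a ha => by rw [smul_mul', hx a ha, hy a ha]
      one_mem' := fun a _ => smul_one a
      inv_mem' := fun {x} hx a ha => by rw [smul_inv', hx a ha] }
  have hFinv : ∀ h : H, ∀ v ∈ F A, h • v ∈ F A := by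
    intro h v hv a ha
    have := hv _ (by simpa using hAn.conj_mem a ha h⁻¹ : h⁻¹ * a * h ∈ A)
    rw [mul_smul, mul_smul] at this
    rw [inv_smul_eq_iff.mp this]
  have hFA : F A = ⊥ := by
    rcases hirr (F A) hFinv with h | h
    · exact h
    · exact absurd (hfaith a₀ fun v => (h ▸ Subgroup.mem_top v : v ∈ F A) a₀ ha₀) ha₀1
  -- `A` is irreducible
  have hAirr : ∀ M : Subgroup V, (∀ a ∈ A, ∀ v ∈ M, a • v ∈ M) → M = ⊥ ∨ M = ⊤ := by
    let P : Set (Subgroup V) := {S | S ≠ ⊥ ∧ ∀ a ∈ A, ∀ v ∈ S, a • v ∈ S}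
    have hVt : Nontrivial V := by
      rw [← Finite.one_lt_card_iff_nontrivial, hV]
      exact Nat.one_lt_two_pow hk.ne_zero
    have hP : P.Nonempty := ⟨⊤, top_ne_bot, fun _ _ _ _ => Subgroup.mem_top _⟩
    obtain ⟨W, ⟨hW, hWA⟩, hWmin⟩ := (Set.toFinite P).exists_minimal hP
    have hmin : ∀ M : Subgroup V, M ≤ W → (∀ a ∈ A, ∀ v ∈ M, a • v ∈ M) → M = ⊥ ∨ M = W := by
      intro M hMW hM
      by_cases hM0 : M = ⊥
      · exact Or.inl hM0
      · exact Or.inr (le_antisymm hMW (hWmin ⟨hM0, hM⟩ hMW))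
    obtain ⟨m, hm⟩ := MulDistribMulAction.exists_card_eq_pow_of_irreducible hirr A W hW hmin hWA
    obtain ⟨j, -, hj⟩ := (Nat.dvd_prime_pow Nat.prime_two).mp (hV ▸ Subgroup.card_subgroup_dvd_card W)
    have hkm : k = j * m := by
      rw [hV, hj, ← pow_mul] at hm
      exact Nat.pow_right_injective le_rfl hm
    suffices W = ⊤ by
      intro M hM
      exact this ▸ hmin M (this ▸ le_top) hM
    rcases (Nat.dvd_prime hk).mp ⟨m, hkm⟩ with rfl | rfl
    -- Here `W` has two elements, so `A` must fix its only nontrivial one, contradicting `hFA`.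
    · exfalso
      apply hW
      rw [← le_bot_iff, ← hFA]
      intro w hw a ha
      have hcW : Nat.card W = 2 := by simpa using hj
      by_cases hw1 : w = 1
      · rw [hw1, smul_one]
      · have h2 : a • w ≠ 1 := hne a w hw1
        obtain ⟨x, y, hxy, hU⟩ := Nat.card_eq_two_iff.mp hcW
        have key : ∀ z : W, z = x ∨ z = y := fun z => by
          have : z ∈ ({x, y} : Set W) := hU ▸ Set.mem_univ z
          simpa using this
        have e1 := key 1
        have e2 := key ⟨w, hw⟩
        have e3 := key ⟨a • w, hWA a ha w hw⟩
        have n1 : (⟨w, hw⟩ : W) ≠ 1 := fun h => hw1 (congrArg Subtype.val h)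
        have n2 : (⟨a • w, hWA a ha w hw⟩ : W) ≠ 1 := fun h => h2 (congrArg Subtype.val h)
        have : (⟨a • w, hWA a ha w hw⟩ : W) = ⟨w, hw⟩ := by grind
        exact congrArg Subtype.val this
    · exact Subgroup.eq_top_of_card_eq W (by rw [hj, hV])
  -- `A` acts semiregularly on the nontrivial vectors
  have hsemi : ∀ a ∈ A, ∀ v : V, v ≠ 1 → a • v = v → a = 1 := by
    intro a ha v hv hav
    have hFinv : ∀ b ∈ A, ∀ w ∈ F {a}, b • w ∈ F {a} := by
      rintro b hb w hw _ rfl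
      rw [smul_smul, hcomm _ ha b hb, mul_smul, hw _ rfl]
    rcases hAirr (F {a}) hFinv with h | h
    · have : v ∈ F {a} := by rintro _ rfl; exact hav
      rw [h, Subgroup.mem_bot] at this
      exact absurd this hv
    · exact hfaith a fun w => (h ▸ Subgroup.mem_top w : w ∈ F {a}) a rfl
  have hinj : ∀ v : V, v ≠ 1 → ∀ a ∈ A, ∀ b ∈ A, a • v = b • v → a = b := by
    intro v hv a ha b hb hab
    refine (inv_mul_eq_one.mp (hsemi _ (A.mul_mem (A.inv_mem ha) hb) v hv ?_))
    rw [mul_smul, ← hab, inv_smul_smul]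
  -- the order of `A`
  have : Fact r.Prime := ⟨hr⟩
  have hcompl : Nat.card {v : V // v ≠ 1} = 2 ^ k - 1 := by
    have := Fintype.ofFinite V
    rw [← hV, Nat.card_eq_fintype_card, Nat.card_eq_fintype_card, Fintype.card_subtype_compl]
    simp
  have hAp : IsPGroup r A := fun a => ⟨1, by
    rw [pow_one]; exact Subtype.ext (hexp a a.2)⟩
  -- The `r`-group `A` fixes only the identity, so `r` divides the prime `2 ^ k - 1` and equals it.
  -- Semiregularity then becomes regularity on nontrivial vectors.
  have hmod := hAp.card_modEq_card_fixedPoints V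
  have hfix : Nat.card (MulAction.fixedPoints A V) = 1 := by
    rw [Nat.card_eq_one_iff_unique]
    refine ⟨⟨fun x y => Subtype.ext ?_⟩, ⟨1, fun a => smul_one a⟩⟩
    have h1 : ∀ x : MulAction.fixedPoints A V, (x : V) = 1 := fun x => by
      have : (x : V) ∈ F A := fun a ha => x.2 ⟨a, ha⟩
      rwa [hFA, Subgroup.mem_bot] at this
    rw [h1, h1]
  rw [hV, hfix] at hmod
  have hrq : r = 2 ^ k - 1 := by
    have : r ∣ 2 ^ k - 1 := (Nat.modEq_iff_dvd' Nat.one_le_two_pow).mp hmod.symm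
    exact (Nat.prime_dvd_prime_iff_eq hr hq).mp this
  have hcardA : 2 ^ k - 1 ≤ Nat.card A := by
    have h1 : orderOf a₀ = r := orderOf_eq_prime (hexp a₀ ha₀) ha₀1
    rw [← hrq, ← h1, ← Nat.card_zpowers]
    exact Subgroup.card_le_of_le (Subgroup.zpowers_le.mpr ha₀)
  have htrans : ∀ v : V, v ≠ 1 → ∀ w : V, w ≠ 1 → ∃ a ∈ A, a • v = w := by
    intro v hv w hw
    let f : A → {v : V // v ≠ 1} := fun a => ⟨(a : H) • v, hne a v hv⟩
    have hf : Function.Injective f := fun a b hab =>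
      Subtype.ext (hinj v hv a a.2 b b.2 (congrArg Subtype.val hab))
    have hfb := hf.bijective_of_nat_card_le (by rw [hcompl]; exact hcardA)
    obtain ⟨a, ha⟩ := hfb.2 ⟨w, hw⟩
    exact ⟨a, a.2, congrArg Subtype.val ha⟩
  by_contra! hcon
  obtain ⟨v, w, hv, hw, hv1, hw1, hvw⟩ : ∃ v w : V, g • v = v ∧ g • w = w ∧ v ≠ 1 ∧ w ≠ 1 ∧
      v ≠ w := by
    have := Fintype.ofFinite (MulAction.fixedBy V g)
    rw [Nat.card_eq_fintype_card, ← Finset.card_univ, Finset.two_lt_card] at hcon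
    obtain ⟨a, -, b, -, c, -, hab, hac, hbc⟩ := hcon
    have e1 : (a : V) ≠ b := fun h => hab (Subtype.ext h)
    have e2 : (a : V) ≠ c := fun h => hac (Subtype.ext h)
    have e3 : (b : V) ≠ c := fun h => hbc (Subtype.ext h)
    by_cases h1 : (a : V) = 1
    · exact ⟨b, c, b.2, c.2, fun h => e1 (h1.trans h.symm), fun h => e2 (h1.trans h.symm), e3⟩
    · by_cases h2 : (b : V) = 1
      · exact ⟨a, c, a.2, c.2, h1, fun h => e3 (h2.trans h.symm), e2⟩
      · exact ⟨a, b, a.2, b.2, h1, h2, e1⟩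
  obtain ⟨a, ha, hav⟩ := htrans v hv1 w hw1
  have ha1 : a ≠ 1 := fun h => hvw (by rw [← hav, h, one_smul])
  -- Both sides lie in `A` and send `v` to `w`. As `A` has prime order, `a` generates it, so `g`
  -- centralizes `A` and fixes the whole orbit of `v`.
  have hga : g * a * g⁻¹ = a := by
    refine hinj v hv1 _ (hAn.conj_mem a ha g) a ha ?_
    have hgv : g⁻¹ • v = v := by rw [inv_smul_eq_iff, hv]
    rw [mul_smul, mul_smul, hgv, hav, hw]
  have hgA : ∀ b ∈ A, g * b = b * g := by
    intro b hb
    have hz : Subgroup.zpowers a = A := by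
      refine Subgroup.eq_of_le_of_card_ge (Subgroup.zpowers_le.mpr ha) ?_
      rw [Nat.card_zpowers, orderOf_eq_prime (hexp a ha) ha1, hrq, ← hcompl]
      let f : A → {v : V // v ≠ 1} := fun a => ⟨(a : H) • v, hne a v hv1⟩
      exact Nat.card_le_card_of_injective f fun a b hab =>
        Subtype.ext (hinj v hv1 a a.2 b b.2 (congrArg Subtype.val hab))
    obtain ⟨n, rfl⟩ := Subgroup.mem_zpowers_iff.mp (hz ▸ hb)
    have : Commute g a := mul_inv_eq_iff_eq_mul.mp hga
    exact this.zpow_right n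
  refine hg (hfaith g fun u => ?_)
  by_cases hu : u = 1
  · rw [hu, smul_one]
  · obtain ⟨b, hb, rfl⟩ := htrans v hv1 u hu
    rw [smul_smul, hgA b hb, mul_smul, hv]

end Irreducible

/-! ### Fixed points and orbits in solvable primitive groups. -/

section Primitive

variable {G : Type*} [Group G] {H N : Subgroup G}

/-- The intersection is centralized by `N` and normalized by `H`, hence normal in `G`. This is the
faithfulness of the conjugation action of `H` on `N`. -/
theorem Subgroup.inf_centralizer_eq_bot_of_isComplement' [N.Normal] (hc : N.IsComplement' H)
    (hcore : ∀ M : Subgroup G, M.Normal → M ≤ H → M = ⊥) :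
    H ⊓ Subgroup.centralizer (N : Set G) = ⊥ := by
  have hn : (Subgroup.centralizer (N : Set G)).Normal := inferInstance
  refine hcore _ (Subgroup.normal_of_normalized_of_sup_eq_top hc.sup_eq_top ?_ ?_) inf_le_left
  · rintro n hn m ⟨hm, hm'⟩
    rw [show n * m = m * n from hm' n hn, mul_inv_cancel_right]
    exact ⟨hm, hm'⟩
  · rintro h hh m ⟨hm, hm'⟩
    exact ⟨H.mul_mem (H.mul_mem hh hm) (H.inv_mem hh), hn.conj_mem m hm' h⟩

/-- Conjugation makes `N` a faithful `H`-module. It is irreducible because an `H`-invariant subgroup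
of `N` is normal in `G`, and by maximality of `H` it is trivial or itself complements `H`. -/
theorem Subgroup.card_inf_centralizer_le_two_of_mersenne [Finite G] [Group.IsSolvable G] [N.Normal]
    (hcomm : ∀ a ∈ N, ∀ b ∈ N, a * b = b * a) (hH : IsCoatom H)
    (hcore : ∀ M : Subgroup G, M.Normal → M ≤ H → M = ⊥) (hc : N.IsComplement' H)
    {k : ℕ} (hN : Nat.card N = 2 ^ k) (hq : (2 ^ k - 1).Prime) {g : G} (hgH : g ∈ H)
    (hg : g ≠ 1) : Nat.card (N ⊓ Subgroup.centralizer {g} : Subgroup G) ≤ 2 := by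
  let : CommGroup N := { mul_comm := fun a b => Subtype.ext (hcomm a a.2 b b.2) }
  let act : MulDistribMulAction H N :=
    MulDistribMulAction.compHom N (ConjAct.toConjAct.toMonoidHom.comp H.subtype)
  have hact : ∀ (h : H) (n : N), ((h • n : N) : G) = h * n * (h : G)⁻¹ := fun h n => rfl
  have : FaithfulSMul H N := by
    refine ⟨fun {a b} hab => ?_⟩
    have h1 : ((a⁻¹ * b : H) : G) ∈ H ⊓ Subgroup.centralizer (N : Set G) := by
      refine ⟨(a⁻¹ * b).2, fun n hn => ?_⟩
      have h2 : (a⁻¹ * b) • (⟨n, hn⟩ : N) = ⟨n, hn⟩ := by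
        rw [mul_smul, ← hab, inv_smul_smul]
      have h3 := congrArg Subtype.val h2
      rw [hact] at h3
      exact (mul_inv_eq_iff_eq_mul.mp h3).symm
    rw [Subgroup.inf_centralizer_eq_bot_of_isComplement' hc hcore, Subgroup.mem_bot,
      OneMemClass.coe_eq_one] at h1
    exact inv_mul_eq_one.mp h1
  have hirr : ∀ M : Subgroup N, (∀ h : H, ∀ v ∈ M, h • v ∈ M) → M = ⊥ ∨ M = ⊤ := by
    intro M hM
    have hnorm : (M.map N.subtype).Normal := by
      refine Subgroup.normal_of_normalized_of_sup_eq_top hc.sup_eq_top ?_ ?_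
      · rintro n hn _ ⟨m, hm, rfl⟩
        refine ⟨m, hm, ?_⟩
        change (m : G) = n * m * n⁻¹
        rw [hcomm n hn m m.2, mul_inv_cancel_right]
      · rintro h hh _ ⟨m, hm, rfl⟩
        exact ⟨_, hM ⟨h, hh⟩ m hm, rfl⟩
    by_cases hle : M.map N.subtype ≤ H
    · left
      have := hcore _ hnorm hle
      rwa [Subgroup.map_eq_bot_iff_of_injective _ N.subtype_injective] at this
    · right
      have hsup : M.map N.subtype ⊔ H = ⊤ := hH.2 _ (lt_of_le_of_ne le_sup_right fun h =>
        hle (h ▸ le_sup_left))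
      refine eq_top_iff.mpr fun n _ => ?_
      have : (n : G) ∈ ((M.map N.subtype ⊔ H : Subgroup G) : Set G) := by rw [hsup]; trivial
      rw [Subgroup.normal_mul] at this
      obtain ⟨_, ⟨m, hm, rfl⟩, h, hh, hmh⟩ := Set.mem_mul.mp this
      have h1 : h ∈ N := by
        have : h = (m : G)⁻¹ * n := by rw [← hmh]; simp
        rw [this]
        exact N.mul_mem (N.inv_mem m.2) n.2
      rw [Subgroup.disjoint_def.mp hc.disjoint h1 hh, mul_one] at hmh
      rwa [← (Subtype.ext hmh : m = n)]
  have key := MulDistribMulAction.card_fixed_le_two_of_mersenne (V := N) (H := H) hirr hN hq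
    ⟨g, hgH⟩ (fun h => hg (congrArg Subtype.val h))
  refine le_trans (Nat.card_le_card_of_injective
    (fun n : (N ⊓ Subgroup.centralizer {g} : Subgroup G) =>
      (⟨⟨n, n.2.1⟩, ?_⟩ : MulAction.fixedBy N (⟨g, hgH⟩ : H))) ?_) key
  · refine Subtype.ext ?_
    rw [hact]
    have := n.2.2
    exact mul_inv_eq_iff_eq_mul.mpr (Subgroup.mem_centralizer_singleton_iff.mp this).symm
  · intro a b hab
    have h1 := congrArg (fun z : MulAction.fixedBy N (⟨g, hgH⟩ : H) => ((z : N) : G)) hab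
    exact Subtype.ext h1

/-- The number of orbits of a nontrivial subgroup of a solvable primitive permutation group. -/
theorem Group.IsSolvable.exists_index_eq_prime_pow_and_card_orbits_le [Finite G]
    [Group.IsSolvable G] (hH : IsCoatom H) (hcore : H.normalCore = ⊥) :
    ∃ p k : ℕ, p.Prime ∧ 0 < k ∧ H.index = p ^ k ∧ ∀ D : Subgroup G, D ≠ ⊥ →
      2 * Nat.card (MulAction.orbitRel.Quotient D (G ⧸ H)) ≤ p ^ k + p ^ (k - 1) ∧
      (p = 2 → (2 ^ k - 1).Prime →
        2 * Nat.card (MulAction.orbitRel.Quotient D (G ⧸ H)) ≤ 2 ^ k + 2) := by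
  replace hcore : ∀ M : Subgroup G, M.Normal → M ≤ H → M = ⊥ := fun M hM hMH =>
    le_bot_iff.mp (hcore ▸ Subgroup.normal_le_normalCore.mpr hMH)
  have : Nontrivial G := by
    by_contra h
    rw [not_nontrivial_iff_subsingleton] at h
    exact hH.1 (Subsingleton.elim _ _)
  obtain ⟨N, p, hp, hNn, hN, hcomm, hexp⟩ :=
    Group.IsSolvable.exists_normal_commutative_exponent_prime G
  have hc := Subgroup.isComplement'_of_commutative_of_isCoatom hN hcomm hH hcore
  have : Fact p.Prime := ⟨hp⟩
  have hNp : IsPGroup p N := fun a => ⟨1, by rw [pow_one]; exact Subtype.ext (hexp a a.2)⟩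
  obtain ⟨k, hk⟩ := IsPGroup.iff_card.mp hNp
  have hk0 : 0 < k := by
    refine Nat.pos_of_ne_zero fun h => hN ?_
    rw [h, pow_zero] at hk
    exact Subgroup.card_eq_one.mp hk
  have hindex : H.index = p ^ k := hc.index_eq_card.trans hk
  refine ⟨p, k, hp, hk0, hindex, fun D hD => ?_⟩
  obtain ⟨g, hgD, hg⟩ := D.bot_or_exists_ne_one.resolve_left hD
  have horb := MulAction.two_mul_card_orbits_le (X := G ⧸ H) (⟨g, hgD⟩ : D)
  rw [← Subgroup.index_eq_card, hindex] at horb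
  have hfix : Nat.card (MulAction.fixedBy (G ⧸ H) (⟨g, hgD⟩ : D)) ≤ p ^ (k - 1) ∧
      (p = 2 → (2 ^ k - 1).Prime →
        Nat.card (MulAction.fixedBy (G ⧸ H) (⟨g, hgD⟩ : D)) ≤ 2) := by
    change Nat.card (MulAction.fixedBy (G ⧸ H) g) ≤ _ ∧
      (_ → _ → Nat.card (MulAction.fixedBy (G ⧸ H) g) ≤ 2)
    rcases (MulAction.fixedBy (G ⧸ H) g).eq_empty_or_nonempty with h0 | ⟨x, hx⟩
    · rw [h0]
      simp
    obtain ⟨x, rfl⟩ := QuotientGroup.mk_surjective x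
    have hle := Subgroup.card_fixedBy_quotient_le hc g x hx
    have hx' : g • (x : G ⧸ H) = x := hx
    have hgx : x⁻¹ * g * x ∈ H := by
      rw [MulAction.Quotient.smul_coe, smul_eq_mul] at hx'
      have := QuotientGroup.eq.mp hx'.symm
      rwa [← mul_assoc] at this
    have hgx1 : x⁻¹ * g * x ≠ 1 := fun h => hg (by
      have : g = x * (x⁻¹ * g * x) * x⁻¹ := by group
      rw [this, h]; group)
    constructor
    · refine hle.trans ?_
      obtain ⟨j, -, hj⟩ := (Nat.dvd_prime_pow hp).mp (hk ▸ Subgroup.card_dvd_of_le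
        (inf_le_left : N ⊓ Subgroup.centralizer {g} ≤ N))
      rw [hj]
      refine Nat.pow_le_pow_right hp.pos (Nat.le_sub_one_of_lt ?_)
      -- Otherwise `g` centralizes `N`, and so does its conjugate in `H`, which must then be
      -- trivial.
      by_contra hjk
      have heq : N ⊓ Subgroup.centralizer {g} = N := by
        refine Subgroup.eq_of_le_of_card_ge inf_le_left ?_
        rw [hj, hk]
        exact Nat.pow_le_pow_right hp.pos (not_lt.mp hjk)
      have h1 : g ∈ Subgroup.centralizer (N : Set G) := fun n hn =>
        (Subgroup.mem_centralizer_singleton_iff.mp ((inf_eq_left.mp heq) hn))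
      have h2 : x⁻¹ * g * x ∈ H ⊓ Subgroup.centralizer (N : Set G) := by
        refine ⟨hgx, ?_⟩
        have hcn : (Subgroup.centralizer (N : Set G)).Normal := inferInstance
        have := hcn.conj_mem g h1 x⁻¹
        rwa [inv_inv] at this
      rw [Subgroup.inf_centralizer_eq_bot_of_isComplement' hc hcore] at h2
      exact hgx1 h2
    · rintro rfl hq
      refine hle.trans (le_trans ?_
        (Subgroup.card_inf_centralizer_le_two_of_mersenne hcomm hH hcore hc hk hq hgx hgx1))
      refine Nat.card_le_card_of_injective
        (fun n : (N ⊓ Subgroup.centralizer {g} : Subgroup G) =>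
          (⟨x⁻¹ * n * x, ?_, ?_⟩ :
            (N ⊓ Subgroup.centralizer {x⁻¹ * g * x} : Subgroup G))) ?_
      · simpa using hNn.conj_mem n n.2.1 x⁻¹
      · change _ ∈ Subgroup.centralizer _
        have h1 : (n : G) * g = g * n := Subgroup.mem_centralizer_singleton_iff.mp n.2.2
        rw [Subgroup.mem_centralizer_singleton_iff]
        calc x⁻¹ * n * x * (x⁻¹ * g * x) = x⁻¹ * (n * g) * x := by group
          _ = x⁻¹ * g * x * (x⁻¹ * n * x) := by rw [h1]; group
      · intro a b hab
        have := congrArg Subtype.val hab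
        simpa using this
  exact ⟨by omega, fun h1 h2 => by have := hfix.2 h1 h2; subst h1; omega⟩

end Primitive

/-! ### Primes in a fixed ring as orbits of a decomposition group. -/

section PrimesOver

open scoped Pointwise

/-- Let a finite group `G` act on `T` with invariants `R`, and let a subgroup `H` have invariants
`S`. The primes of `S` over `p` correspond to the orbits on `G ⧸ H` of the decomposition group of a
prime of `T` over `p`. -/
theorem Algebra.IsInvariant.card_primesOver_eq_card_orbits {R S T G : Type*} [CommRing R]
    [CommRing S] [CommRing T] [Algebra R S] [Algebra S T] [Algebra R T] [IsScalarTower R S T]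
    [Group G] [Finite G] [MulSemiringAction G T] [SMulCommClass G R T] [Algebra.IsInvariant R T G]
    (H : Subgroup G) [SMulCommClass H S T] [Algebra.IsInvariant S T H] [FaithfulSMul S T]
    (p : Ideal R) (P : Ideal T) [P.IsPrime] [P.LiesOver p] :
    Nat.card (MulAction.orbitRel.Quotient (MulAction.stabilizer G P) (G ⧸ H)) =
      Nat.card (p.primesOver S) := by
  have hint : Algebra.IsIntegral S T := Algebra.IsInvariant.isIntegral S T H
  have hunder : ∀ (g : G) , ((g • P).under S) ∈ p.primesOver S := fun g => by
    have : (g • P).LiesOver p := by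
      have h1 : g • P ∈ p.primesOver T :=
        Algebra.IsInvariant.orbit_eq_primesOver R T G p P ▸ MulAction.mem_orbit P g
      exact h1.2
    exact ⟨inferInstance, ⟨by rw [Ideal.under_under]; exact (g • P).over_def p⟩⟩
  have hH : ∀ (h : H) (Q : Ideal T) , (h • Q).under S = Q.under S := fun h Q => by
    ext s
    rw [Ideal.mem_under, Ideal.mem_under]
    change algebraMap S T s ∈ (h : G) • Q ↔ _
    rw [Ideal.mem_pointwise_smul_iff_inv_smul_mem]
    have : (h : G)⁻¹ • algebraMap S T s = algebraMap S T s := smul_algebraMap h⁻¹ s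
    rw [this]
  -- The inverse makes the map well defined on left cosets: `gh` gives `h⁻¹g⁻¹P`, which has the same
  -- trace on `S`. It also absorbs left multiplication by the stabilizer of `P`.
  let f : G ⧸ H → p.primesOver S := fun x => Quotient.liftOn' x
    (fun g => ⟨(g⁻¹ • P).under S, hunder g⁻¹⟩) fun a b hab => by
      rw [QuotientGroup.leftRel_apply] at hab
      refine Subtype.ext ?_
      change (a⁻¹ • P).under S = (b⁻¹ • P).under S
      rw [← hH ⟨a⁻¹ * b, hab⟩ (b⁻¹ • P), Subgroup.mk_smul, smul_smul, mul_inv_cancel_right]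
  have hf : ∀ g : G, (f g : Ideal S) = (g⁻¹ • P).under S := fun g => rfl
  let F : MulAction.orbitRel.Quotient (MulAction.stabilizer G P) (G ⧸ H) → p.primesOver S :=
    fun o => Quotient.liftOn' o f fun x y hxy => by
      obtain ⟨⟨d, hd⟩, rfl⟩ := hxy
      obtain ⟨y, rfl⟩ := QuotientGroup.mk_surjective y
      refine Subtype.ext ?_
      change (f ((d * y : G) : G ⧸ H) : Ideal S) = _
      rw [hf, hf, mul_inv_rev, mul_smul, inv_smul_eq_iff.mpr (MulAction.mem_stabilizer_iff.mp hd).symm]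
  refine Nat.card_congr (Equiv.ofBijective F ⟨?_, ?_⟩)
  · rintro ⟨x⟩ ⟨y⟩ hxy
    obtain ⟨x, rfl⟩ := QuotientGroup.mk_surjective x
    obtain ⟨y, rfl⟩ := QuotientGroup.mk_surjective y
    have h1 : (x⁻¹ • P).under S = (y⁻¹ • P).under S := congrArg Subtype.val hxy
    obtain ⟨h, hh⟩ := Algebra.IsInvariant.exists_smul_of_under_eq S T H _ _ h1
    replace hh : y⁻¹ • P = (h : G) • x⁻¹ • P := hh
    rw [smul_smul, inv_smul_eq_iff, smul_smul] at hh
    refine Quotient.sound' ?_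
    rw [MulAction.orbitRel_apply]
    refine MulAction.mem_orbit_symm.mp ⟨⟨y * (h * x⁻¹), MulAction.mem_stabilizer_iff.mpr hh.symm⟩, ?_⟩
    change (((y * (h * x⁻¹)) * x : G) : G ⧸ H) = (y : G ⧸ H)
    rw [eq_comm, QuotientGroup.eq]
    simp [mul_assoc]
  · rintro ⟨Q, hQ, hQp⟩
    obtain ⟨P', -, hP', hPQ⟩ := Ideal.exists_ideal_over_prime_of_isIntegral Q (⊥ : Ideal T) (by
      rw [← RingHom.ker_eq_comap_bot,
        (RingHom.injective_iff_ker_eq_bot _).mp (FaithfulSMul.algebraMap_injective S T)]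
      exact bot_le)
    have : P'.LiesOver p :=
      ⟨by rw [← Ideal.under_under (B := S), Ideal.under_def (A := S), hPQ]; exact Q.over_def p⟩
    obtain ⟨g, rfl⟩ := Algebra.IsInvariant.exists_smul_of_under_eq R T G P P'
      ((P.over_def p).symm.trans (P'.over_def p))
    refine ⟨Quotient.mk'' ((g⁻¹ : G) : G ⧸ H), Subtype.ext ?_⟩
    change (f ((g⁻¹ : G) : G ⧸ H) : Ideal S) = Q
    rw [hf, inv_inv]
    exact hPQ

/-- The previous count applies to the integral closure of `R` in `N`: as `R` and `S` are integrally
closed, they are its invariants under the Galois group and under the subgroup fixing `L`. -/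
theorem IsIntegrallyClosed.exists_subgroup_card_primesOver_eq {R S K L N : Type*} [CommRing R]
    [CommRing S] [Field K] [Field L] [Field N] [Algebra R S] [Algebra R K] [Algebra S L]
    [Algebra R L] [Algebra K L] [Algebra R N] [Algebra S N] [Algebra K N] [Algebra L N]
    [IsScalarTower R S L] [IsScalarTower R K L] [IsScalarTower R K N] [IsScalarTower R S N]
    [IsScalarTower S L N] [IsScalarTower K L N] [IsFractionRing R K] [IsFractionRing S L]
    [IsIntegrallyClosed R] [IsIntegrallyClosed S] [Algebra.IsIntegral R S] [IsGalois K N]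
    [FiniteDimensional K N] (p : Ideal R) [p.IsPrime] :
    ∃ D : Subgroup Gal(N/K),
      Nat.card (MulAction.orbitRel.Quotient D
        (Gal(N/K) ⧸ (IsScalarTower.toAlgHom K L N).fieldRange.fixingSubgroup)) =
      Nat.card (p.primesOver S) := by
  set H := (IsScalarTower.toAlgHom K L N).fieldRange.fixingSubgroup with hH
  have : SMulCommClass Gal(N/K) R N := ⟨fun g r n => by
    rw [AlgEquiv.smul_def, AlgEquiv.smul_def, ← IsScalarTower.algebraMap_smul K r n,
      ← IsScalarTower.algebraMap_smul K r (g n), map_smul]⟩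
  have hS : ∀ s : S, IsIntegral R (algebraMap S N s) := fun s =>
    (Algebra.IsIntegral.isIntegral (R := R) s).map (IsScalarTower.toAlgHom R S N)
  let _ : Algebra S (integralClosure R N) :=
    ((algebraMap S N).codRestrict (integralClosure R N) hS).toAlgebra
  have hST : ∀ s : S, ((algebraMap S (integralClosure R N) s : integralClosure R N) : N) =
    algebraMap S N s := fun s => rfl
  have hsmul : ∀ (g : Gal(N/K)) (t : integralClosure R N), ((g • t : integralClosure R N) : N) =
    g (t : N) := fun g t => rfl
  have : IsScalarTower R S (integralClosure R N) := .of_algebraMap_eq fun r => Subtype.ext <| by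
    rw [hST, ← IsScalarTower.algebraMap_apply]; rfl
  have : FaithfulSMul S (integralClosure R N) := by
    rw [faithfulSMul_iff_algebraMap_injective]
    intro a b hab
    have h1 := congrArg Subtype.val hab
    rw [hST, hST, IsScalarTower.algebraMap_apply S L N, IsScalarTower.algebraMap_apply S L N] at h1
    exact IsFractionRing.injective S L ((algebraMap L N).injective h1)
  have hfix : ∀ (h : H) (l : L), (h : Gal(N/K)) (algebraMap L N l) = algebraMap L N l := fun h l =>
    h.2 ⟨algebraMap L N l, l, rfl⟩
  have : SMulCommClass H S (integralClosure R N) := ⟨fun h s t => Subtype.ext <| by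
    change (h : Gal(N/K)) ((s • t : integralClosure R N) : N) = _
    rw [Algebra.smul_def, Algebra.smul_def]
    change (h : Gal(N/K)) (algebraMap S N s * t) = algebraMap S N s * (h : Gal(N/K)) t
    rw [map_mul, IsScalarTower.algebraMap_apply S L N, hfix]⟩
  have : Algebra.IsInvariant R (integralClosure R N) Gal(N/K) := ⟨fun b hb => by
    have h1 : (b : N) ∈ (⊥ : IntermediateField K N) := by
      rw [← IsGalois.fixedField_top]
      rintro ⟨g, -⟩
      exact congrArg Subtype.val (hb g)
    obtain ⟨x, hx⟩ := IntermediateField.mem_bot.mp h1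
    have h2 : IsIntegral R x := by
      rw [← isIntegral_algebraMap_iff (algebraMap K N).injective, hx]
      exact b.2
    obtain ⟨r, rfl⟩ := IsIntegrallyClosed.algebraMap_eq_of_integral h2
    exact ⟨r, Subtype.ext (by rw [← hx, ← IsScalarTower.algebraMap_apply]; rfl)⟩⟩
  have : Algebra.IsInvariant S (integralClosure R N) H := ⟨fun b hb => by
    have h1 : (b : N) ∈ (IsScalarTower.toAlgHom K L N).fieldRange := by
      rw [← IsGalois.fixedField_fixingSubgroup (IsScalarTower.toAlgHom K L N).fieldRange]
      intro g
      exact congrArg Subtype.val (hb g)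
    obtain ⟨x, hx⟩ := h1
    replace hx : algebraMap L N x = b := hx
    have h2 : IsIntegral S x := by
      have : IsIntegral R x := by
        have hx' : IsIntegral R (algebraMap L N x) := hx ▸ b.2
        have : IsScalarTower R L N := .of_algebraMap_eq fun r => by
          rw [IsScalarTower.algebraMap_apply R K L, ← IsScalarTower.algebraMap_apply K L N,
            ← IsScalarTower.algebraMap_apply R K N]
        rwa [isIntegral_algebraMap_iff (algebraMap L N).injective] at hx'
      exact this.tower_top
    obtain ⟨r, rfl⟩ := IsIntegrallyClosed.algebraMap_eq_of_integral h2
    exact ⟨r, Subtype.ext (by rw [← hx, hST, ← IsScalarTower.algebraMap_apply])⟩⟩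
  have hinj : Function.Injective (algebraMap R (integralClosure R N)) := by
    intro a b hab
    have h1 : algebraMap R N a = algebraMap R N b := congrArg Subtype.val hab
    rw [IsScalarTower.algebraMap_apply R K N, IsScalarTower.algebraMap_apply R K N] at h1
    exact IsFractionRing.injective R K ((algebraMap K N).injective h1)
  obtain ⟨P, -, hP, hPp⟩ := Ideal.exists_ideal_over_prime_of_isIntegral p
    (⊥ : Ideal (integralClosure R N)) (by
      rw [← RingHom.ker_eq_comap_bot, (RingHom.injective_iff_ker_eq_bot _).mp hinj]
      exact bot_le)
  have : P.LiesOver p := ⟨hPp.symm⟩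
  exact ⟨_, Algebra.IsInvariant.card_primesOver_eq_card_orbits H p P⟩

end PrimesOver

/-! ### Translation by the Galois correspondence. -/

section GaloisGroup

variable {K L N : Type*} [Field K] [Field L] [Field N] [Algebra K L] [Algebra K N] [Algebra L N]
  [IsScalarTower K L N]

/-- An element of the core fixes every conjugate of `L`, and these generate `N`. -/
theorem IsNormalClosure.normalCore_fixingSubgroup_eq_bot [Algebra.IsAlgebraic K L]
    [IsNormalClosure K L N] :
    (IsScalarTower.toAlgHom K L N).fieldRange.fixingSubgroup.normalCore = ⊥ := by
  have hN : Normal K N := IsNormalClosure.normal (K := L)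
  rw [eq_bot_iff]
  intro g hg
  have htop : IntermediateField.normalClosure K L N = ⊤ :=
    (Algebra.IsAlgebraic.isNormalClosure_iff.mp ‹_›).2
  have hle : IntermediateField.normalClosure K L N ≤
      IntermediateField.fixedField (Subgroup.zpowers g) := by
    refine normalClosure_le_iff.mpr ?_
    rintro f _ ⟨l, rfl⟩
    obtain ⟨σ, hσ⟩ : ∃ σ : Gal(N/K), σ (algebraMap L N l) = f l := by
      refine minpoly.exists_algEquiv_of_root' (hN.isAlgebraic _) ?_
      rw [minpoly.algebraMap_eq (algebraMap L N).injective, Polynomial.aeval_algHom_apply,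
        minpoly.aeval, map_zero]
    have h1 : σ⁻¹ * g * σ ∈ (IsScalarTower.toAlgHom K L N).fieldRange.fixingSubgroup := by
      simpa using hg σ⁻¹
    have h2 : (σ⁻¹ * g * σ) (algebraMap L N l) = algebraMap L N l := h1 ⟨_, l, rfl⟩
    have h3 : g (f l) = f l := by
      rw [← hσ]
      have := congrArg σ h2
      simpa [AlgEquiv.mul_apply] using this
    have h4 : Subgroup.zpowers g ≤ MulAction.stabilizer Gal(N/K) (f l) := by
      rw [Subgroup.zpowers_le]
      exact h3
    rintro ⟨τ, hτ⟩
    exact h4 hτ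
  rw [Subgroup.mem_bot]
  ext x
  have hx : x ∈ IntermediateField.fixedField (Subgroup.zpowers g) :=
    hle (htop ▸ IntermediateField.mem_top)
  exact hx ⟨g, Subgroup.mem_zpowers g⟩

theorem IsGalois.isCoatom_fixingSubgroup_fieldRange [IsGalois K N] [FiniteDimensional K N]
    (h : ∀ F : IntermediateField K L, F = ⊥ ∨ F = ⊤) (hd : Module.finrank K L ≠ 1) :
    IsCoatom (IsScalarTower.toAlgHom K L N).fieldRange.fixingSubgroup := by
  set E := (IsScalarTower.toAlgHom K L N).fieldRange with hE
  constructor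
  · intro htop
    apply hd
    have h1 : E = ⊥ := by
      rw [← IsGalois.fixedField_fixingSubgroup E, htop, IsGalois.fixedField_top]
    have h2 : Module.finrank K E = 1 := by rw [h1, IntermediateField.finrank_bot]
    rw [← h2]
    exact (AlgEquiv.ofInjectiveField (IsScalarTower.toAlgHom K L N)).toLinearEquiv.finrank_eq
  · intro J hJ
    have hle : IntermediateField.fixedField J ≤ E := by
      rw [← IsGalois.fixedField_fixingSubgroup E]
      exact IntermediateField.fixedField_antitone hJ.le
    rcases h ((IntermediateField.fixedField J).comap (IsScalarTower.toAlgHom K L N)) with h | h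
    · have : IntermediateField.fixedField J = ⊥ := by
        rw [eq_bot_iff]
        intro x hx
        obtain ⟨l, rfl⟩ := hle hx
        have hl : l ∈ (IntermediateField.fixedField J).comap (IsScalarTower.toAlgHom K L N) := hx
        rw [h] at hl
        obtain ⟨k, rfl⟩ := IntermediateField.mem_bot.mp hl
        exact IntermediateField.mem_bot.mpr ⟨k, IsScalarTower.algebraMap_apply K L N k⟩
      rw [← IntermediateField.fixingSubgroup_fixedField J, this, IntermediateField.fixingSubgroup_bot]
    · exfalso
      refine hJ.ne (le_antisymm hJ.le ?_)
      rw [← IntermediateField.le_iff_le]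
      rintro _ ⟨l, rfl⟩
      have hl : l ∈ (IntermediateField.fixedField J).comap (IsScalarTower.toAlgHom K L N) :=
        h ▸ IntermediateField.mem_top
      exact hl

theorem IsGalois.index_fixingSubgroup_fieldRange [IsGalois K N] :
    (IsScalarTower.toAlgHom K L N).fieldRange.fixingSubgroup.index = Module.finrank K L := by
  rw [← IntermediateField.finrank_eq_fixingSubgroup_index]
  exact (AlgEquiv.ofInjectiveField (IsScalarTower.toAlgHom K L N)).toLinearEquiv.finrank_eq.symm

/-- The degree of a finite extension without intermediate fields whose Galois group is solvable,
and the number of orbits on its embeddings of a nontrivial subgroup of the Galois group. -/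
theorem IsGalois.exists_finrank_eq_prime_pow_and_card_orbits_le [IsGalois K N]
    [FiniteDimensional K L] [IsNormalClosure K L N]
    [FiniteDimensional K N] (h : ∀ F : IntermediateField K L, F = ⊥ ∨ F = ⊤)
    (hs : Group.IsSolvable Gal(N/K)) :
    ∃ p k : ℕ, p.Prime ∧ Module.finrank K L = p ^ k ∧ ∀ D : Subgroup Gal(N/K), D ≠ ⊥ →
      2 * Nat.card (MulAction.orbitRel.Quotient D
        (Gal(N/K) ⧸ (IsScalarTower.toAlgHom K L N).fieldRange.fixingSubgroup)) ≤
          p ^ k + p ^ (k - 1) ∧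
      (p = 2 → (p ^ k - 1).Prime →
        2 * Nat.card (MulAction.orbitRel.Quotient D
          (Gal(N/K) ⧸ (IsScalarTower.toAlgHom K L N).fieldRange.fixingSubgroup)) ≤ 2 ^ k + 2) := by
  have hcore := IsNormalClosure.normalCore_fixingSubgroup_eq_bot (K := K) (L := L) (N := N)
  have hindex := IsGalois.index_fixingSubgroup_fieldRange (K := K) (L := L) (N := N)
  by_cases hd : Module.finrank K L = 1
  -- In degree one any prime would do; the Galois group is trivial, so no nontrivial `D` exists.
  · refine ⟨2, 0, Nat.prime_two, by rw [hd, pow_zero], fun D hD => absurd ?_ hD⟩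
    rw [hd, Subgroup.index_eq_one] at hindex
    rw [hindex, Subgroup.normalCore_eq_self] at hcore
    exact le_bot_iff.mp (hcore ▸ le_top)
  · obtain ⟨p, k, hp, -, hk, hD⟩ :=
      Group.IsSolvable.exists_index_eq_prime_pow_and_card_orbits_le
        (IsGalois.isCoatom_fixingSubgroup_fieldRange h hd) hcore
    exact ⟨p, k, hp, hindex ▸ hk, fun D hD' => ⟨(hD D hD').1, fun h2 => by
      subst h2; exact (hD D hD').2 rfl⟩⟩

end GaloisGroup

/-! ### Ramification indices over an algebraically closed field. -/

section Ramification

theorem Ideal.algebraMap_quotient_bijective_of_isAlgClosed (k : Type*) {A : Type*} [Field k]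
    [IsAlgClosed k] [CommRing A] [Algebra k A] [Algebra.FiniteType k A] (m : Ideal A)
    [m.IsMaximal] : Function.Bijective (algebraMap k (A ⧸ m)) := by
  let _ := Ideal.Quotient.field m
  have : Module.Finite k (A ⧸ m) := finite_of_finite_type_of_isJacobsonRing k (A ⧸ m)
  exact IsAlgClosed.algebraMap_bijective_of_isIntegral

/-- By the Nullstellensatz both residue fields are `k`. This removes the residue degrees from the
fundamental identity. -/
theorem Ideal.inertiaDeg_eq_one_of_isAlgClosed (k : Type*) {R S : Type*} [Field k] [IsAlgClosed k]
    [CommRing R] [CommRing S] [Algebra k R] [Algebra k S] [Algebra R S] [IsScalarTower k R S]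
    [Algebra.FiniteType k R] [Algebra.FiniteType k S] (p : Ideal R) [p.IsMaximal] (q : Ideal S)
    [q.IsMaximal] [q.LiesOver p] : q.inertiaDeg R = 1 := by
  rw [Ideal.inertiaDeg_eq_of_isMaximal p q]
  let _ := Ideal.Quotient.field p
  let _ := Ideal.Quotient.field q
  have h : Function.Surjective (algebraMap (R ⧸ p) (S ⧸ q)) := fun x => by
    obtain ⟨a, rfl⟩ := (Ideal.algebraMap_quotient_bijective_of_isAlgClosed k q).2 x
    exact ⟨algebraMap k (R ⧸ p) a, (IsScalarTower.algebraMap_apply k (R ⧸ p) (S ⧸ q) a).symm⟩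
  rw [← Module.finrank_self (R ⧸ p)]
  exact (LinearEquiv.ofBijective (Algebra.linearMap (R ⧸ p) (S ⧸ q))
    ⟨(algebraMap (R ⧸ p) (S ⧸ q)).injective, h⟩).finrank_eq.symm

theorem Ideal.finsum_ramificationIdx_eq_finrank (k : Type*) {R S K L : Type*} [Field k]
    [IsAlgClosed k] [CommRing R] [CommRing S] [Field K] [Field L] [Algebra k R] [Algebra k S]
    [Algebra R S] [IsScalarTower k R S] [Algebra.FiniteType k R] [Algebra.FiniteType k S]
    [Algebra R K] [Algebra S L] [Algebra R L] [Algebra K L]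
    [IsScalarTower R S L] [IsScalarTower R K L] [IsFractionRing R K] [IsFractionRing S L]
    [IsDedekindDomain R] [Module.Finite R S] [Module.IsTorsionFree R S]
    (p : Ideal R) [p.IsMaximal] :
    ∑ᶠ q : p.primesOver S, q.1.ramificationIdx R = Module.finrank K L := by
  have : Finite (p.primesOver S) := Algebra.QuasiFinite.finite_primesOver p
  have := Fintype.ofFinite (p.primesOver S)
  rw [finsum_eq_sum_of_fintype, IsFractionRing.finrank_eq R K S L,
    ← Ideal.sum_ramification_inertia_eq_finrank p S]
  refine Finset.sum_congr rfl fun q _ => ?_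
  have : q.1.LiesOver p := q.2.2
  have : q.1.IsMaximal := Ideal.IsMaximal.of_liesOver_isMaximal q.1 p
  rw [Ideal.inertiaDeg_eq_one_of_isAlgClosed k p q.1, mul_one]

/-- A lower bound for the contribution of a ramified prime to the branch divisor. -/
theorem Ideal.finrank_le_two_mul_finsum_ramificationIdx_sub_one (k : Type*) {R S K L N : Type*}
    [Field k] [IsAlgClosed k] [CommRing R] [CommRing S] [Field K] [Field L] [Field N]
    [Algebra k R] [Algebra k S] [Algebra R S] [IsScalarTower k R S] [Algebra.FiniteType k R]
    [Algebra.FiniteType k S] [Algebra R K] [Algebra S L] [Algebra R L] [Algebra K L]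
    [Algebra R N] [Algebra S N] [Algebra K N] [Algebra L N] [IsScalarTower R K N]
    [IsScalarTower R S N] [IsScalarTower S L N] [IsScalarTower K L N]
    [IsScalarTower R S L] [IsScalarTower R K L] [IsFractionRing R K] [IsFractionRing S L]
    [IsDedekindDomain R] [IsIntegrallyClosed S] [Module.Finite R S] [Module.IsTorsionFree R S]
    [IsGalois K N] [FiniteDimensional K N] (p : Ideal R) [p.IsMaximal] (m : ℕ)
    (hm : ∀ D : Subgroup Gal(N/K), D ≠ ⊥ → 2 * Nat.card (MulAction.orbitRel.Quotient D
        (Gal(N/K) ⧸ (IsScalarTower.toAlgHom K L N).fieldRange.fixingSubgroup)) ≤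
          Module.finrank K L + m)
    (hp : ∃ q : p.primesOver S, 1 < q.1.ramificationIdx R) :
    Module.finrank K L ≤ 2 * (∑ᶠ q : p.primesOver S, (q.1.ramificationIdx R - 1)) + m := by
  have : Finite (p.primesOver S) := Algebra.QuasiFinite.finite_primesOver p
  have := Fintype.ofFinite (p.primesOver S)
  have hsum := Ideal.finsum_ramificationIdx_eq_finrank k (S := S) (K := K) (L := L) p
  obtain ⟨D, hD⟩ := IsIntegrallyClosed.exists_subgroup_card_primesOver_eq
    (S := S) (K := K) (L := L) (N := N) p
  rw [finsum_eq_sum_of_fintype] at hsum ⊢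
  have hpos : ∀ q : p.primesOver S, 1 ≤ q.1.ramificationIdx R := fun q =>
    Ideal.ramificationIdx_pos q.1 R
  have hb : ∑ q : p.primesOver S, (q.1.ramificationIdx R - 1) + Nat.card (p.primesOver S) =
      Module.finrank K L := by
    rw [← hsum, Nat.card_eq_fintype_card, ← Finset.card_univ, Finset.card_eq_sum_ones,
      ← Finset.sum_add_distrib]
    exact Finset.sum_congr rfl fun q _ => Nat.sub_add_cancel (hpos q)
  -- For trivial `D` the orbits are single cosets, so there are as many primes as the degree and
  -- `hb` leaves no room for ramification.
  have hD0 : D ≠ ⊥ := by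
    rintro rfl
    obtain ⟨q, hq⟩ := hp
    have h1 : Nat.card (p.primesOver S) = Module.finrank K L := by
      rw [← hD, ← IsGalois.index_fixingSubgroup_fieldRange (K := K) (L := L) (N := N),
        Subgroup.index_eq_card]
      refine (Nat.card_congr (Equiv.ofBijective Quotient.mk''
        ⟨fun x y hxy => ?_, Quotient.mk''_surjective⟩)).symm
      obtain ⟨⟨g, hg⟩, rfl⟩ := Quotient.exact' hxy
      obtain rfl := Subgroup.mem_bot.mp hg
      exact one_smul _ y
    have h2 : 0 < ∑ q : p.primesOver S, (q.1.ramificationIdx R - 1) :=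
      Finset.sum_pos' (fun _ _ => Nat.zero_le _) ⟨q, Finset.mem_univ _, by omega⟩
    omega
  have := hm D hD0
  omega

end Ramification

/-! ### Smooth algebras over a field are integrally closed. -/

section Smooth

open scoped TensorProduct

attribute [local instance] Algebra.TensorProduct.rightAlgebra in
/-- A domain which is étale over an integrally closed domain is integrally closed. -/
theorem Algebra.Etale.isIntegrallyClosed (P B : Type*) [CommRing P] [CommRing B] [IsDomain P]
    [IsDomain B] [Algebra P B] [Algebra.Etale P B] [IsIntegrallyClosed P] :
    IsIntegrallyClosed B := by
  have hflat : Module.Flat P B := inferInstance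
  have hinj : Function.Injective (algebraMap P B) := by
    rw [← faithfulSMul_iff_algebraMap_injective]
    infer_instance
  have hM : Algebra.algebraMapSubmonoid B (nonZeroDivisors P) ≤ nonZeroDivisors B := by
    rintro _ ⟨x, hx, rfl⟩
    exact mem_nonZeroDivisors_of_ne_zero
      ((map_ne_zero_iff _ hinj).mpr (nonZeroDivisors.ne_zero hx))
  have hloc : IsLocalization (Algebra.algebraMapSubmonoid B (nonZeroDivisors P))
      (B ⊗[P] FractionRing P) := inferInstance
  have hdom : IsDomain (B ⊗[P] FractionRing P) :=
    IsLocalization.isDomain_of_le_nonZeroDivisors (M := Algebra.algebraMapSubmonoid B _) _ hM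
  have : Algebra.Etale (FractionRing P) (B ⊗[P] FractionRing P) :=
    Algebra.Etale.of_equiv (Algebra.TensorProduct.commRight P (FractionRing P) B)
  have : Module.Finite (FractionRing P) (B ⊗[P] FractionRing P) :=
    Algebra.FormallyUnramified.finite_of_free (FractionRing P) _
  -- The generic fibre is an étale domain over a field, hence finite over it and a field; so it is
  -- the fraction field of `B`.
  have hfield : IsField (B ⊗[P] FractionRing P) :=
    isField_of_isIntegral_of_isField' (Field.toIsField (FractionRing P))
  have : IsFractionRing B (B ⊗[P] FractionRing P) := by
    refine IsLocalization.of_le _ _ hM fun r hr => ?_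
    obtain ⟨s, hs⟩ := hfield.mul_inv_cancel (a := algebraMap B (B ⊗[P] FractionRing P) r)
      ((map_ne_zero_iff _ (IsLocalization.injective _ hM)).mpr (nonZeroDivisors.ne_zero hr))
    exact IsUnit.of_mul_eq_one s hs
  -- Integral closure commutes with smooth base change, and `P` is its own integral closure in its
  -- fraction field.
  have hbij := TensorProduct.toIntegralClosure_bijective_of_smooth (R := P) (S := B)
    (B := FractionRing P)
  rw [isIntegrallyClosed_iff (B ⊗[P] FractionRing P)]
  intro x hx
  obtain ⟨t, ht⟩ := hbij.2 ⟨x, hx⟩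
  obtain rfl : ((TensorProduct.toIntegralClosure P B (FractionRing P) t :
    integralClosure B (B ⊗[P] FractionRing P)) : B ⊗[P] FractionRing P) = x :=
    congrArg Subtype.val ht
  clear hx ht
  induction t with
  | zero => exact ⟨0, by simp⟩
  | add a b ha hb =>
    obtain ⟨a', ha⟩ := ha
    obtain ⟨b', hb⟩ := hb
    exact ⟨a' + b', by rw [map_add, ha, hb, map_add]; rfl⟩
  | tmul b y =>
    obtain ⟨r, hr⟩ := IsIntegrallyClosed.algebraMap_eq_of_integral y.2
    refine ⟨r • b, ?_⟩
    change (r • b) ⊗ₜ[P] (1 : FractionRing P) = b ⊗ₜ[P] (y : FractionRing P)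
    rw [TensorProduct.smul_tmul, ← hr, Algebra.algebraMap_eq_smul_one]

/-- Near each maximal ideal a smooth algebra is étale over a polynomial ring, which is integrally
closed, and the property can be checked at maximal ideals. -/
theorem Algebra.Smooth.isIntegrallyClosed (k A : Type*) [Field k] [CommRing A] [IsDomain A]
    [Algebra k A] [Algebra.Smooth k A] : IsIntegrallyClosed A := by
  refine IsIntegrallyClosed.of_localization_maximal fun m _ hm => ?_
  obtain ⟨f, hf, n, _, _, _⟩ := Algebra.IsSmoothAt.exists_isStandardEtale_mvPolynomial (R := k) (p := m)
  have hf0 : f ≠ 0 := fun h => hf (h ▸ m.zero_mem)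
  have : IsDomain (Localization.Away f) := IsLocalization.isDomain_localization
    (powers_le_nonZeroDivisors_of_noZeroDivisors hf0)
  have : Algebra.Etale (MvPolynomial (Fin n) k) (Localization.Away f) := inferInstance
  have := Algebra.Etale.isIntegrallyClosed (MvPolynomial (Fin n) k) (Localization.Away f)
  let _ : Algebra (Localization.Away f) (Localization.AtPrime m) :=
    (IsLocalization.Away.lift f (g := algebraMap A (Localization.AtPrime m))
      (IsLocalization.map_units (M := m.primeCompl) _ ⟨f, hf⟩)).toAlgebra
  have : IsScalarTower A (Localization.Away f) (Localization.AtPrime m) :=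
    .of_algebraMap_eq fun a => (IsLocalization.Away.lift_eq f _ a).symm
  have : IsLocalization (m.primeCompl.map (algebraMap A (Localization.Away f)))
      (Localization.AtPrime m) :=
    IsLocalization.isLocalization_of_submonoid_le _ _ (Submonoid.powers f) m.primeCompl
      (Submonoid.powers_le.mpr hf)
  refine isIntegrallyClosed_of_isLocalization (R := Localization.Away f) _
    (m.primeCompl.map (algebraMap A (Localization.Away f))) ?_
  rintro _ ⟨x, hx, rfl⟩
  refine mem_nonZeroDivisors_of_ne_zero ?_
  rw [map_ne_zero_iff _ (IsLocalization.injective _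
    (powers_le_nonZeroDivisors_of_noZeroDivisors hf0))]
  exact fun h => hx (h ▸ m.zero_mem)

end Smooth

/-! ### Smoothness of Dedekind algebras over an algebraically closed field. -/

section Dedekind

open Polynomial

/-- A local parameter `t` defines a map to the affine line. It is flat because `A` is torsion-free
over `k[X]`, and unramified at `m` because `t` generates the maximal ideal there and the residue
field is `k`; hence it is étale at `m`. -/
theorem Algebra.IsSmoothAt.of_isDiscreteValuationRing (k : Type*) {A : Type*} [Field k]
    [IsAlgClosed k] [CommRing A] [IsDomain A] [Algebra k A] [Algebra.FiniteType k A]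
    (m : Ideal A) [m.IsMaximal] [IsDiscreteValuationRing (Localization.AtPrime m)] :
    Algebra.IsSmoothAt k m := by
  obtain ⟨ϖ, hϖ⟩ := IsDiscreteValuationRing.exists_irreducible (Localization.AtPrime m)
  obtain ⟨t, s, hts⟩ := IsLocalization.exists_mk'_eq m.primeCompl ϖ
  have hspan : Ideal.span {algebraMap A (Localization.AtPrime m) t} =
      IsLocalRing.maximalIdeal (Localization.AtPrime m) := by
    rw [hϖ.maximalIdeal_eq, Ideal.span_singleton_eq_span_singleton]
    have hs : IsUnit (algebraMap A (Localization.AtPrime m) s) := IsLocalization.map_units _ s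
    refine ⟨hs.unit⁻¹, ?_⟩
    rw [← hts, Units.mul_inv_eq_iff_eq_mul, IsUnit.unit_spec, IsLocalization.mk'_spec]
  have htm : t ∈ m := by
    rw [← IsLocalization.AtPrime.to_map_mem_maximal_iff (Localization.AtPrime m) m, ← hspan]
    exact Ideal.mem_span_singleton_self _
  have ht0 : t ≠ 0 := by
    rintro rfl
    rw [IsLocalization.mk'_zero] at hts
    exact hϖ.ne_zero hts.symm
  -- If `t` were algebraic over `k` it would be a nonzero constant, hence a unit, although it lies
  -- in `m`.
  have htrans : Function.Injective (aeval (R := k) t) := by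
    refine transcendental_iff_injective.mp fun halg => ?_
    have hint : IsIntegral k t := halg.isIntegral
    obtain ⟨c, hc⟩ : ∃ c, algebraMap k A c = t := by
      obtain ⟨c, hc⟩ := (IsAlgClosed.algebraMap_bijective_of_isIntegral
        (k := k) (K := integralClosure k A)).2 ⟨t, hint⟩
      exact ⟨c, congrArg Subtype.val hc⟩
    have hc0 : c ≠ 0 := by
      rintro rfl
      exact ht0 (by rw [← hc, map_zero])
    exact ‹m.IsMaximal›.ne_top (m.eq_top_of_isUnit_mem htm (hc ▸ (IsUnit.mk0 c hc0).map _))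
  let _ : Algebra k[X] A := (aeval t).toRingHom.toAlgebra
  have hX : algebraMap k[X] A X = t := aeval_X t
  have : IsScalarTower k k[X] A := .of_algebraMap_eq fun c => (aeval_C t c).symm
  have : FaithfulSMul k[X] A := (faithfulSMul_iff_algebraMap_injective _ _).mpr htrans
  have : Module.IsTorsionFree k[X] A := inferInstance
  have : Module.Flat k[X] A := inferInstance
  have : Algebra.FiniteType k[X] A := .of_restrictScalars_finiteType k _ _
  have : Algebra.FinitePresentation k[X] A := Algebra.FinitePresentation.of_finiteType.mp this
  let p := m.under k[X]
  have hp : X ∈ p := by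
    rw [Ideal.mem_under, hX]; exact htm
  let _ := Localization.AtPrime.algebraOfLiesOver p m
  have hun : Algebra.IsUnramifiedAt k[X] m := by
    rw [Algebra.isUnramifiedAt_iff_map_eq k[X] p m]
    constructor
    · have hsurj : Function.Surjective (algebraMap p.ResidueField m.ResidueField) := by
        intro x
        obtain ⟨y, rfl⟩ := (Ideal.bijective_algebraMap_quotient_residueField m).2 x
        obtain ⟨c, rfl⟩ := (Ideal.algebraMap_quotient_bijective_of_isAlgClosed k m).2 y
        refine ⟨algebraMap k[X] p.ResidueField (C c), ?_⟩
        rw [← IsScalarTower.algebraMap_apply k[X], IsScalarTower.algebraMap_apply k[X] A,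
          ← IsScalarTower.algebraMap_apply k (A ⧸ m), IsScalarTower.algebraMap_apply k A]
        congr 1
        exact aeval_C t c
      refine ⟨fun x => ?_⟩
      obtain ⟨y, rfl⟩ := hsurj x
      exact isSeparable_algebraMap y
    · refine le_antisymm ?_ ?_
      · rw [IsScalarTower.algebraMap_eq k[X] A, ← Ideal.map_map, ← Localization.AtPrime.map_eq_maximalIdeal]
        exact Ideal.map_mono Ideal.map_comap_le
      · rw [← hspan, Ideal.span_singleton_le_iff_mem, ← hX, ← IsScalarTower.algebraMap_apply]
        exact Ideal.mem_map_of_mem _ hp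
  have : Algebra.IsEtaleAt k[X] m := Algebra.IsEtaleAt.of_isUnramifiedAt_of_flat m
  have : Algebra.FormallyEtale k[X] (Localization.AtPrime m) := this
  exact Algebra.FormallySmooth.comp k k[X] (Localization.AtPrime m)

/-- The smooth locus is open, hence stable under generalization, so maximal ideals suffice; their
local rings are discrete valuation rings. -/
theorem Algebra.Smooth.of_isDedekindDomain (k A : Type*) [Field k] [IsAlgClosed k] [CommRing A]
    [IsDedekindDomain A] [Algebra k A] [Algebra.FiniteType k A] (hA : ¬ IsField A) :
    Algebra.Smooth k A := by
  have hfp : Algebra.FinitePresentation k A := Algebra.FinitePresentation.of_finiteType.mp ‹_›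
  have hmax : ∀ m : Ideal A, m.IsMaximal → ∀ hm : m.IsPrime, Algebra.IsSmoothAt k m := by
    intro m hmm hm
    have := IsLocalization.AtPrime.isDiscreteValuationRing_of_dedekind_domain A
      (Ring.ne_bot_of_isMaximal_of_not_isField hmm hA) (Localization.AtPrime m)
    exact Algebra.IsSmoothAt.of_isDiscreteValuationRing k m
  refine ⟨Algebra.smoothLocus_eq_univ_iff.mp (Set.eq_univ_iff_forall.mpr fun q => ?_), hfp⟩
  obtain ⟨m, hm, hqm⟩ := Ideal.exists_le_maximal q.asIdeal q.2.ne_top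
  have h1 : (⟨m, hm.isPrime⟩ : PrimeSpectrum A) ∈ Algebra.smoothLocus k A := hmax m hm hm.isPrime
  exact Algebra.isOpen_smoothLocus.stableUnderGeneralization
    ((PrimeSpectrum.le_iff_specializes q ⟨m, hm.isPrime⟩).mp hqm) h1

end Dedekind

/-! ### Krull dimension by open covers. -/

section Dimension

/-- A chain of irreducible closed sets above `Z` survives restriction to any open set meeting `Z`,
so coheights can be computed locally. -/
theorem topologicalKrullDim_le_of_forall_exists_isOpen {T : Type*} [TopologicalSpace T]
    {n : WithBot ℕ∞}
    (h : ∀ x : T, ∃ U : Set T, IsOpen U ∧ x ∈ U ∧ topologicalKrullDim U ≤ n) :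
    topologicalKrullDim T ≤ n := by
  rw [topologicalKrullDim, Order.krullDim_eq_iSup_coheight]
  refine iSup_le fun Z => ?_
  obtain ⟨x, hx⟩ := Z.2.nonempty
  obtain ⟨U, hU, hxU, hn⟩ := h x
  have hemb : Topology.IsOpenEmbedding ((↑) : U → T) := hU.isOpenEmbedding_subtypeVal
  let e := TopologicalSpace.IrreducibleCloseds.orderIsoOfIsOpenEmbedding _ hemb
  let Z' : TopologicalSpace.IrreducibleCloseds U := e.symm ⟨Z, ⟨⟨x, hxU⟩, hx⟩⟩
  have hZ : TopologicalSpace.IrreducibleCloseds.map _ hemb.continuous Z' = Z :=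
    congrArg Subtype.val (e.apply_symm_apply ⟨Z, ⟨⟨x, hxU⟩, hx⟩⟩)
  rw [← hZ, hemb.coheight_map]
  exact (Order.coheight_le_krullDim _).trans hn

theorem AlgebraicGeometry.IsAffineOpen.topologicalKrullDim_eq {X : Scheme} {U : X.Opens}
    (hU : IsAffineOpen U) : topologicalKrullDim U = ringKrullDim Γ(X, U) := by
  rw [← PrimeSpectrum.topologicalKrullDim_eq_ringKrullDim]
  exact hU.isoSpec.hom.homeomorph.isHomeomorph.topologicalKrullDim_eq

theorem IsDedekindDomain.ringKrullDim_eq_one (R : Type*) [CommRing R] [IsDedekindDomain R]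
    (h : ¬ IsField R) : ringKrullDim R = 1 := by
  have : Ring.KrullDimLE 1 R :=
    Ring.krullDimLE_one_iff_of_noZeroDivisors.mpr fun _ hI hp => hp.isMaximal hI
  refine eq_of_le_of_not_lt (by rwa [← Nat.cast_one, ← Ring.krullDimLE_iff]) fun h' => h ?_
  have h'' : ringKrullDim R ≤ 0 := Order.le_of_lt_succ h'
  rw [← Nat.cast_zero, ← Ring.krullDimLE_iff] at h''
  exact Ring.KrullDimLE.isField_of_isDomain

end Dimension

/-! ### Affine charts of curves. -/

namespace CurveCovering

noncomputable instance sectionsAlgebra (X : Over (Spec (CommRingCat.of ℂ))) (U : X.left.Opens) :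
    Algebra ℂ Γ(X.left, U) :=
  ((Scheme.ΓSpecIso (CommRingCat.of ℂ)).inv ≫ X.hom.appLE ⊤ U (by simp)).hom.toAlgebra

theorem algebraMap_sections_appLE {X Y : Over (Spec (CommRingCat.of ℂ))} (π : X ⟶ Y)
    (U : Y.left.Opens) (V : X.left.Opens) (e : V ≤ π.left ⁻¹ᵁ U) (c : ℂ) :
    π.left.appLE U V e (algebraMap ℂ Γ(Y.left, U) c) = algebraMap ℂ Γ(X.left, V) c := by
  have key : ∀ f : X.left ⟶ Spec (CommRingCat.of ℂ), π.left ≫ Y.hom = f →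
      Scheme.Hom.appLE (Y := Spec (CommRingCat.of ℂ)) Y.hom ⊤ U (by simp) ≫
        π.left.appLE U V e = f.appLE ⊤ V (by simp) := by
    rintro _ rfl
    exact Scheme.Hom.appLE_comp_appLE ..
  have h : CommRingCat.ofHom (algebraMap ℂ Γ(Y.left, U)) ≫ π.left.appLE U V e =
      CommRingCat.ofHom (algebraMap ℂ Γ(X.left, V)) :=
    (Category.assoc ..).trans (congrArg (_ ≫ ·) (key X.hom (Over.w π)))
  exact congr($h c)

section Charts

variable (X : Over (Spec (CommRingCat.of ℂ)))

theorem finiteType_sections [LocallyOfFiniteType X.hom] {U : X.left.Opens}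
    (hU : IsAffineOpen U) : Algebra.FiniteType ℂ Γ(X.left, U) := by
  have h := X.hom.finiteType_appLE (isAffineOpen_top _) hU le_top
  rw [← RingHom.finiteType_algebraMap]
  exact h.comp (.of_surjective _ (ConcreteCategory.bijective_of_isIso
    (Scheme.ΓSpecIso (CommRingCat.of ℂ)).inv).2)

theorem smooth_sections_iff {U : X.left.Opens} :
    Algebra.Smooth ℂ Γ(X.left, U) ↔ (X.hom.appLE ⊤ U (by simp)).hom.Smooth := by
  rw [← RingHom.smooth_algebraMap]
  exact RingHom.Smooth.propertyIsLocal.respectsIso.cancel_left_isIso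
    (Scheme.ΓSpecIso (CommRingCat.of ℂ)).inv (X.hom.appLE ⊤ U (by simp))

variable [IsCurve X]

/-- A curve is a Jacobson space, so an open point would be closed and, by connectedness, the whole
curve, which has dimension one. -/
theorem not_isOpen_singleton (x : X.left) : ¬ IsOpen {x} := by
  intro hx
  have : JacobsonSpace X.left := LocallyOfFiniteType.jacobsonSpace X.hom
  have hc : IsClosed {x} := isClosed_singleton_of_isLocallyClosed_singleton hx.isLocallyClosed
  have hu : ({x} : Set X.left) = Set.univ :=
    IsClopen.eq_univ ⟨hc, hx⟩ (Set.singleton_nonempty x)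
  have : Subsingleton X.left :=
    Set.subsingleton_univ_iff.mp (hu ▸ Set.subsingleton_singleton)
  have : DiscreteTopology X.left := inferInstance
  have h0 := topologicalKrullDim_zero_of_discreteTopology X.left
  rw [IsCurve.dim_eq_one] at h0
  exact absurd h0 (by decide)

variable {X} {U : X.left.Opens} (hU : IsAffineOpen U)
include hU

theorem not_isField_sections [Nonempty U] : ¬ IsField Γ(X.left, U) := by
  intro h
  obtain ⟨x⟩ := ‹Nonempty U›
  have h1 : Subsingleton (Spec Γ(X.left, U)) := by
    let _ := h.toField
    exact inferInstanceAs (Subsingleton (PrimeSpectrum Γ(X.left, U)))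
  have h2 : Subsingleton U := hU.isoSpec.hom.homeomorph.injective.subsingleton (β := Spec Γ(X.left, U))
  refine not_isOpen_singleton X x.1 ?_
  convert U.isOpen
  ext y
  exact ⟨fun hy => hy ▸ x.2, fun hy => congrArg Subtype.val (h2.elim (⟨y, hy⟩ : U) x)⟩

theorem isDedekindDomain_sections [Nonempty U] : IsDedekindDomain Γ(X.left, U) := by
  have := finiteType_sections X hU
  have : IsNoetherianRing Γ(X.left, U) := Algebra.FiniteType.isNoetherianRing ℂ _
  have : Algebra.Smooth ℂ Γ(X.left, U) :=
    (smooth_sections_iff X).mpr (X.hom.smooth_appLE (isAffineOpen_top _) hU le_top)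
  have : IsIntegrallyClosed Γ(X.left, U) := Algebra.Smooth.isIntegrallyClosed ℂ _
  have : Ring.KrullDimLE 1 Γ(X.left, U) := by
    rw [Ring.krullDimLE_iff, ← hU.topologicalKrullDim_eq]
    exact (topologicalKrullDim_subspace_le _ _).trans IsCurve.dim_eq_one.le
  have : Ring.DimensionLEOne Γ(X.left, U) :=
    ⟨fun hp hp' => hp'.isMaximal_of_ne_bot hp⟩
  have : IsDedekindRing Γ(X.left, U) := { }
  exact { }

end Charts

/-- Smoothness and dimension are local. This is how a normalization is recognized as a curve. -/
theorem isCurve_of_isDedekindDomain_sections (X : Over (Spec (CommRingCat.of ℂ)))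
    [IsIntegral X.left] [IsProper X.hom]
    (h : ∀ x : X.left, ∃ U : X.left.Opens, x ∈ U ∧ IsAffineOpen U ∧
      IsDedekindDomain Γ(X.left, U) ∧ ¬ IsField Γ(X.left, U)) : IsCurve X := by
  choose U hxU hU hded hnf using h
  have hdim : ∀ x, topologicalKrullDim (U x) = 1 := fun x => by
    have := hded x
    rw [(hU x).topologicalKrullDim_eq]
    exact IsDedekindDomain.ringKrullDim_eq_one _ (hnf x)
  refine ⟨inferInstance, ?_, inferInstance, le_antisymm ?_ ?_⟩
  · refine HasRingHomProperty.of_iSup_eq_top (P := @Smooth) (fun x => ⟨U x, hU x⟩) ?_ fun x => ?_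
    · exact TopologicalSpace.Opens.ext (Set.eq_univ_iff_forall.mpr fun x => by
        simpa using ⟨x, hxU x⟩)
    · have := hded x
      have := finiteType_sections X (hU x)
      exact (smooth_sections_iff X).mp (Algebra.Smooth.of_isDedekindDomain ℂ _ (hnf x))
  · exact topologicalKrullDim_le_of_forall_exists_isOpen fun x =>
      ⟨U x, (U x).isOpen, hxU x, (hdim x).le⟩
  · obtain ⟨x⟩ : Nonempty X.left := inferInstance
    exact (hdim x).ge.trans (topologicalKrullDim_subspace_le _ _)

end CurveCovering

/-! ### Relative normalization along a ring-valued point. -/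

namespace AlgebraicGeometry.Scheme

/-- The homomorphism `Γ(Y, U) ⟶ E` given by an `E`-valued point of `Y` that lies in `U`. -/
noncomputable def evalPoint {Y : Scheme} {E : CommRingCat} (g : Spec E ⟶ Y) (U : Y.Opens)
    (h : ⊤ ≤ g ⁻¹ᵁ U) : Γ(Y, U) ⟶ E :=
  g.appLE U ⊤ h ≫ (Scheme.ΓSpecIso E).hom

theorem appLE_evalPoint {Y T : Scheme} {E : CommRingCat} (g : Spec E ⟶ T) (q : T ⟶ Y)
    (U : Y.Opens) (V : T.Opens) (e : V ≤ q ⁻¹ᵁ U) (h : ⊤ ≤ g ⁻¹ᵁ V) :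
    q.appLE U V e ≫ evalPoint g V h = evalPoint (g ≫ q) U (h.trans fun _ hx => e hx) := by
  rw [evalPoint, evalPoint, ← Category.assoc, Scheme.Hom.appLE_comp_appLE]

theorem evalPoint_specMap_comp {Y : Scheme} {E E' : CommRingCat} (φ : E ⟶ E') (g : Spec E ⟶ Y)
    (U : Y.Opens) (h : ⊤ ≤ g ⁻¹ᵁ U) :
    evalPoint (Spec.map φ ≫ g) U (fun _ _ => h trivial) = evalPoint g U h ≫ φ := by
  simp only [evalPoint]
  rw [← Scheme.Hom.appLE_comp_appLE (Spec.map φ) g U ⊤ ⊤ h le_top,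
    Category.assoc, Category.assoc, ← Scheme.ΓSpecIso_naturality, Scheme.Hom.appTop,
    Scheme.Hom.app_eq_appLE]
  rfl

theorem evalPoint_fromSpecStalk {Y : Scheme} (y : Y) (U : Y.Opens) (hy : y ∈ U)
    (h : ⊤ ≤ Y.fromSpecStalk y ⁻¹ᵁ U) :
    evalPoint (Y.fromSpecStalk y) U h = Y.presheaf.germ U y hy := by
  rw [evalPoint, Scheme.Hom.appLE, Scheme.fromSpecStalk_app hy]
  simp only [Category.assoc, ← Functor.map_comp_assoc]
  simp only [homOfLE_leOfHom, ← op_comp]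
  simp

theorem evalPoint_toNormalization {Y : Scheme} {E : CommRingCat} (g : Spec E ⟶ Y)
    [QuasiCompact g] [QuasiSeparated g] {U : Y.Opens} (hU : IsAffineOpen U) (h : ⊤ ≤ g ⁻¹ᵁ U)
    (W : g.normalization.Opens) (hW : W = g.fromNormalization ⁻¹ᵁ U)
    (hW' : ⊤ ≤ g.toNormalization ⁻¹ᵁ W) :
    Function.Injective (evalPoint g.toNormalization W hW') ∧
      ∀ x : E, (evalPoint g U h).hom.IsIntegralElem x ↔
        x ∈ Set.range (evalPoint g.toNormalization W hW') := by
  subst hW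
  have hU' : g ⁻¹ᵁ U = ⊤ := top_le_iff.mp h
  let θ : Γ(Spec E, g ⁻¹ᵁ U) ⟶ E :=
    (Spec E).presheaf.map (eqToHom hU'.symm).op ≫ (Scheme.ΓSpecIso E).hom
  have hθ : Function.Bijective θ := ConcreteCategory.bijective_of_isIso θ
  let _ := (g.app U).hom.toAlgebra
  have h1 : evalPoint g U h = g.app U ≫ θ := by
    simp only [θ, evalPoint, Scheme.Hom.appLE, Category.assoc]
    rfl
  have h2 : evalPoint g.toNormalization (g.fromNormalization ⁻¹ᵁ U) hW' =
      (g.normalizationObjIso hU).hom ≫ CommRingCat.ofHom (Subalgebra.val _).toRingHom ≫ θ := by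
    rw [← Category.assoc, Scheme.Hom.normalizationObjIso_hom_val]
    simp only [θ, evalPoint, Scheme.Hom.appLE_map_assoc]
  rw [h1, h2]
  have hiso := ConcreteCategory.bijective_of_isIso (g.normalizationObjIso hU).hom
  refine ⟨hθ.1.comp (Subtype.val_injective.comp hiso.1), fun x => ⟨fun hx => ?_, ?_⟩⟩
  · obtain ⟨z, rfl⟩ := hθ.2 x
    obtain ⟨p, hp, hpz⟩ := hx
    have hz : (g.app U).hom.IsIntegralElem z := by
      refine ⟨p, hp, hθ.1 ?_⟩
      change θ.hom _ = θ.hom _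
      rw [map_zero, Polynomial.hom_eval₂]
      exact hpz
    obtain ⟨b, hb⟩ := hiso.2 ⟨z, hz⟩
    exact ⟨b, congrArg (fun w => θ w.1) hb⟩
  · rintro ⟨b, rfl⟩
    obtain ⟨p, hp, hpz⟩ := ((g.normalizationObjIso hU).hom b).2
    refine ⟨p, hp, ?_⟩
    have := congrArg θ.hom hpz
    rw [map_zero, Polynomial.hom_eval₂] at this
    exact this

/-- The comparison map is integral, hence affine, so it may be tested on sections over affine opens
of `Y`; there both sides are the integral closure in `E`. -/
theorem isIso_normalizationDesc {Y T : Scheme} {E : CommRingCat} (g : Spec E ⟶ Y)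
    [QuasiCompact g] [QuasiSeparated g] (j : Spec E ⟶ T) (q : T ⟶ Y) [IsIntegralHom q]
    (H : g = j ≫ q) (hg : ∀ U : Y.Opens, (U : Set Y).Nonempty → ⊤ ≤ g ⁻¹ᵁ U)
    (hT : ∀ U : Y.Opens, IsAffineOpen U → ∀ (h : ⊤ ≤ g ⁻¹ᵁ U) (h' : ⊤ ≤ j ⁻¹ᵁ (q ⁻¹ᵁ U)),
      Function.Injective (evalPoint j (q ⁻¹ᵁ U) h') ∧
      ∀ x : E, (evalPoint g U h).hom.IsIntegralElem x →
        x ∈ Set.range (evalPoint j (q ⁻¹ᵁ U) h')) :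
    IsIso (g.normalizationDesc j q H) := by
  have hcomp : g.normalizationDesc j q H ≫ q = g.fromNormalization :=
    g.normalizationDesc_comp j q H
  have hto : g.toNormalization ≫ g.normalizationDesc j q H = j :=
    g.toNormalization_normalizationDesc j q H
  generalize g.normalizationDesc j q H = e at hcomp hto
  have : IsIntegralHom (e ≫ q) := by rw [hcomp]; infer_instance
  have : IsIntegralHom e := IsIntegralHom.of_comp e q
  refine IsZariskiLocalAtTarget.of_forall_exists_morphismRestrict (P := .isomorphisms _) fun t => ?_
  obtain ⟨_, ⟨U, hU, rfl⟩, hqU, -⟩ := Y.isBasis_affineOpens.exists_subset_of_mem_open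
    (Set.mem_univ (q t)) isOpen_univ
  refine ⟨q ⁻¹ᵁ U, hqU, (isIso_morphismRestrict_iff_isIso_app _ (hU.preimage q)).mpr ?_⟩
  have h := hg U ⟨_, hqU⟩
  have h' : ⊤ ≤ j ⁻¹ᵁ (q ⁻¹ᵁ U) := by rwa [H] at h
  have hW : e ⁻¹ᵁ (q ⁻¹ᵁ U) = g.fromNormalization ⁻¹ᵁ U := by rw [← hcomp]; rfl
  have hW' : ⊤ ≤ g.toNormalization ⁻¹ᵁ (e ⁻¹ᵁ (q ⁻¹ᵁ U)) := by rwa [← hto] at h'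
  have hfac : e.app (q ⁻¹ᵁ U) ≫ evalPoint g.toNormalization _ hW' =
      evalPoint j (q ⁻¹ᵁ U) h' := by
    rw [Scheme.Hom.app_eq_appLE, appLE_evalPoint]
    simp only [hto]
  obtain ⟨hinj, hint⟩ := evalPoint_toNormalization g hU h _ hW hW'
  obtain ⟨hinj', hint'⟩ := hT U hU h h'
  rw [← hfac] at hinj' hint'
  refine (ConcreteCategory.isIso_iff_bijective _).mpr 
    ⟨fun a b hab => hinj' (by simp [hab]), fun b => ?_⟩
  obtain ⟨s, hs⟩ := hint' _ ((hint _).mpr ⟨b, rfl⟩)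
  exact ⟨s, hinj hs⟩

end AlgebraicGeometry.Scheme

/-! ### Extensions of the function field as points. -/

namespace AlgebraicGeometry.Scheme

/-- The `E`-valued point of an integral scheme given by an extension `E` of its function field. -/
noncomputable def extensionPoint (Y : Scheme) [IrreducibleSpace Y] {E : CommRingCat}
    (φ : Y.functionField ⟶ E) : Spec E ⟶ Y :=
  Spec.map φ ≫ Y.fromSpecStalk (genericPoint Y)

theorem genericPoint_mem_of_nonempty (Y : Scheme) [IrreducibleSpace Y] {U : Y.Opens}
    (hU : (U : Set Y).Nonempty) : genericPoint Y ∈ U :=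
  ((genericPoint_spec Y).mem_open_set_iff U.isOpen).mpr (by simpa using hU)

theorem top_le_fromSpecStalk_preimage (Y : Scheme) (y : Y) {U : Y.Opens} (hy : y ∈ U) :
    ⊤ ≤ Y.fromSpecStalk y ⁻¹ᵁ U := fun t _ => by
  have ht : Y.fromSpecStalk y t ∈ Set.range (Y.fromSpecStalk y) := ⟨t, rfl⟩
  rw [range_fromSpecStalk] at ht
  exact show Y.fromSpecStalk y t ∈ (U : Set Y) from Specializes.mem_open ht U.isOpen hy

theorem top_le_extensionPoint_preimage (Y : Scheme) [IrreducibleSpace Y] {E : CommRingCat}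
    (φ : Y.functionField ⟶ E) {U : Y.Opens} (hU : (U : Set Y).Nonempty) :
    ⊤ ≤ Y.extensionPoint φ ⁻¹ᵁ U := fun _ _ =>
  Y.top_le_fromSpecStalk_preimage _ (Y.genericPoint_mem_of_nonempty hU) trivial

theorem evalPoint_extensionPoint (Y : Scheme) [IrreducibleSpace Y] {E : CommRingCat}
    (φ : Y.functionField ⟶ E) {U : Y.Opens} [Nonempty U] (h : ⊤ ≤ Y.extensionPoint φ ⁻¹ᵁ U) :
    evalPoint (Y.extensionPoint φ) U h = Y.germToFunctionField U ≫ φ := by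
  have hη : genericPoint Y ∈ U := Y.genericPoint_mem_of_nonempty (Set.nonempty_coe_sort.mp ‹_›)
  exact (evalPoint_specMap_comp φ (Y.fromSpecStalk (genericPoint Y)) U
    (Y.top_le_fromSpecStalk_preimage _ hη)).trans
      (congrArg (· ≫ φ) (evalPoint_fromSpecStalk _ _ hη _))

end AlgebraicGeometry.Scheme

/-! ### Normalization of a curve in a finite extension of its function field. -/

namespace CurveCovering

open Scheme

variable (Y : Over (Spec (CommRingCat.of ℂ))) [IsCurve Y]

instance charZero_functionField : CharZero Y.left.functionField :=
  have : Nonempty (⊤ : Y.left.Opens) := ⟨genericPoint Y.left, trivial⟩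
  let φ := (algebraMap Γ(Y.left, ⊤) Y.left.functionField).comp (algebraMap ℂ Γ(Y.left, ⊤))
  (RingHom.charZero_iff (ϕ := φ) (RingHom.injective φ)).mp inferInstance

instance isAffineHom_extensionPoint {E : CommRingCat} (φ : Y.left.functionField ⟶ E) :
    IsAffineHom (Y.left.extensionPoint φ) :=
  have : IsSeparated Y.hom := inferInstance
  have : IsAffineHom (Y.left.extensionPoint φ ≫ Y.hom) := inferInstance
  IsAffineHom.of_comp _ Y.hom

section Normalization

variable {Y} {F : Type} [Field F] (φ : Y.left.functionField ⟶ CommRingCat.of F)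

/-- The normalization of a curve in an extension of its function field. -/
noncomputable def normalizationIn : Over (Spec (CommRingCat.of ℂ)) :=
  Over.mk ((Y.left.extensionPoint φ).fromNormalization ≫ Y.hom)

/-- The structure morphism of the normalization of a curve in an extension of its function field. -/
noncomputable def fromNormalizationIn : normalizationIn φ ⟶ Y :=
  Over.homMk (Y.left.extensionPoint φ).fromNormalization

/-- The generic point of the normalization of a curve in an extension of its function field. -/
noncomputable def toNormalizationIn : Spec (.of F) ⟶ (normalizationIn φ).left :=
  (Y.left.extensionPoint φ).toNormalization

instance : IsIntegral (normalizationIn φ).left :=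
  inferInstanceAs (IsIntegral (Y.left.extensionPoint φ).normalization)

instance : IsIntegralHom (fromNormalizationIn φ).left :=
  inferInstanceAs (IsIntegralHom (Y.left.extensionPoint φ).fromNormalization)

theorem toNormalizationIn_comp : toNormalizationIn φ ≫ (fromNormalizationIn φ).left =
    Y.left.extensionPoint φ :=
  Scheme.Hom.toNormalization_fromNormalization _

theorem top_le_toNormalizationIn_preimage {U : Y.left.Opens} [Nonempty U] :
    ⊤ ≤ toNormalizationIn φ ⁻¹ᵁ ((fromNormalizationIn φ).left ⁻¹ᵁ U) := by
  rw [← Scheme.Hom.comp_preimage, toNormalizationIn_comp]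
  exact top_le_extensionPoint_preimage _ _ (Set.nonempty_coe_sort.mp ‹_›)

/-- Sections of the normalization in `F` as elements of `F`. -/
noncomputable def normalizationInEval (U : Y.left.Opens) [Nonempty U] :
    Γ((normalizationIn φ).left, (fromNormalizationIn φ).left ⁻¹ᵁ U) →+* F :=
  (evalPoint (toNormalizationIn φ) _ (top_le_toNormalizationIn_preimage φ)).hom

theorem normalizationInEval_app (U : Y.left.Opens) [Nonempty U] (r : Γ(Y.left, U)) :
    normalizationInEval φ U ((fromNormalizationIn φ).left.app U r) =
      φ (algebraMap _ Y.left.functionField r) := by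
  have h := appLE_evalPoint (toNormalizationIn φ) (fromNormalizationIn φ).left U _ le_rfl
    (top_le_toNormalizationIn_preimage φ)
  simp only [toNormalizationIn_comp] at h
  rw [evalPoint_extensionPoint] at h
  rw [Scheme.Hom.app_eq_appLE]
  exact congr($h r)

theorem normalizationInEval_injective {U : Y.left.Opens} [Nonempty U] (hU : IsAffineOpen U) :
    Function.Injective (normalizationInEval φ U) :=
  (evalPoint_toNormalization (Y.left.extensionPoint φ) hU
    (top_le_extensionPoint_preimage _ _ (Set.nonempty_coe_sort.mp ‹_›)) _ rfl
    (top_le_toNormalizationIn_preimage φ)).1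

theorem isIntegralElem_iff_mem_range_normalizationInEval {U : Y.left.Opens} [Nonempty U]
    (hU : IsAffineOpen U) (x : F) :
    (φ.hom.comp
      (algebraMap Γ(Y.left, U) Y.left.functionField)).IsIntegralElem x ↔
      x ∈ Set.range (normalizationInEval φ U) := by
  have h := (evalPoint_toNormalization (Y.left.extensionPoint φ) hU
    (top_le_extensionPoint_preimage _ _ (Set.nonempty_coe_sort.mp ‹_›)) _ rfl
    (top_le_toNormalizationIn_preimage φ)).2 x
  rw [evalPoint_extensionPoint] at h
  exact h

theorem isIntegralClosure_normalizationIn {U : Y.left.Opens} [Nonempty U] (hU : IsAffineOpen U) :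
    letI := (normalizationInEval φ U).toAlgebra
    letI := (φ.hom.comp
      (algebraMap Γ(Y.left, U) Y.left.functionField)).toAlgebra
    IsIntegralClosure Γ((normalizationIn φ).left, (fromNormalizationIn φ).left ⁻¹ᵁ U)
      Γ(Y.left, U) F :=
  letI := (normalizationInEval φ U).toAlgebra
  letI := (φ.hom.comp
    (algebraMap Γ(Y.left, U) Y.left.functionField)).toAlgebra
  { algebraMap_injective := normalizationInEval_injective φ hU
    isIntegral_iff := isIntegralElem_iff_mem_range_normalizationInEval φ hU _ }

/-- The sections are the integral closure of a Dedekind domain in a finite extension, separable by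
characteristic zero. -/
theorem sections_normalizationIn (hφ : φ.hom.Finite) {U : Y.left.Opens}
    [Nonempty U] (hU : IsAffineOpen U) :
    ((fromNormalizationIn φ).left.app U).hom.Finite ∧
    IsDedekindDomain Γ((normalizationIn φ).left, (fromNormalizationIn φ).left ⁻¹ᵁ U) ∧
    ¬ IsField Γ((normalizationIn φ).left, (fromNormalizationIn φ).left ⁻¹ᵁ U) := by
  let _ := φ.hom.toAlgebra
  let _ := (normalizationInEval φ U).toAlgebra
  let _ := (φ.hom.comp (algebraMap Γ(Y.left, U) Y.left.functionField)).toAlgebra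
  let _ := ((fromNormalizationIn φ).left.app U).hom.toAlgebra
  have : FiniteDimensional Y.left.functionField F := hφ
  have := isIntegralClosure_normalizationIn φ hU
  have : IsScalarTower Γ(Y.left, U) Y.left.functionField F := .of_algebraMap_eq fun _ => rfl
  have : IsScalarTower Γ(Y.left, U)
      Γ((normalizationIn φ).left, (fromNormalizationIn φ).left ⁻¹ᵁ U) F :=
    .of_algebraMap_eq fun r => (normalizationInEval_app φ U r).symm
  have := isDedekindDomain_sections hU
  have := functionField_isFractionRing_of_isAffineOpen Y.left U hU
  have hfin : Module.Finite Γ(Y.left, U)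
      Γ((normalizationIn φ).left, (fromNormalizationIn φ).left ⁻¹ᵁ U) :=
    IsIntegralClosure.finite Γ(Y.left, U) Y.left.functionField F _
  have : IsDomain Γ((normalizationIn φ).left, (fromNormalizationIn φ).left ⁻¹ᵁ U) :=
    (normalizationInEval_injective φ hU).isDomain (normalizationInEval φ U)
  have hded := IsIntegralClosure.isDedekindDomain Γ(Y.left, U) Y.left.functionField F
    Γ((normalizationIn φ).left, (fromNormalizationIn φ).left ⁻¹ᵁ U)
  refine ⟨hfin, hded, fun h => not_isField_sections hU (isField_of_isIntegral_of_isField ?_ h)⟩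
  have hinj : Function.Injective (algebraMap Γ(Y.left, U) F) := by
    rw [IsScalarTower.algebraMap_eq Γ(Y.left, U) Y.left.functionField F]
    exact (algebraMap Y.left.functionField F).injective.comp (IsFractionRing.injective _ _)
  rw [IsScalarTower.algebraMap_eq Γ(Y.left, U)
    Γ((normalizationIn φ).left, (fromNormalizationIn φ).left ⁻¹ᵁ U) F, RingHom.coe_comp] at hinj
  exact .of_comp hinj

variable (hφ : φ.hom.Finite)
include hφ

theorem isFinite_fromNormalizationIn : IsFinite (fromNormalizationIn φ).left := by
  refine (isFinite_iff _).mpr ⟨inferInstance, fun U hU => ?_⟩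
  obtain rfl | h := eq_or_ne U ⊥
  · have : Subsingleton Γ((normalizationIn φ).left, (fromNormalizationIn φ).left ⁻¹ᵁ ⊥) :=
      inferInstanceAs (Subsingleton Γ((normalizationIn φ).left, ⊥))
    exact .of_surjective _ (fun x => ⟨0, Subsingleton.elim _ _⟩)
  · have : Nonempty U := Set.nonempty_coe_sort.mpr ((TopologicalSpace.Opens.ne_bot_iff_nonempty U).mp h)
    exact (sections_normalizationIn φ hφ hU).1

theorem isCurve_normalizationIn : IsCurve (normalizationIn φ) := by
  have := isFinite_fromNormalizationIn φ hφ
  have : IsProper (normalizationIn φ).hom :=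
    inferInstanceAs (IsProper ((fromNormalizationIn φ).left ≫ Y.hom))
  refine isCurve_of_isDedekindDomain_sections _ fun z => ?_
  obtain ⟨_, ⟨U, hU, rfl⟩, hqU, -⟩ := Y.left.isBasis_affineOpens.exists_subset_of_mem_open
    (Set.mem_univ ((fromNormalizationIn φ).left z)) isOpen_univ
  have : Nonempty U := ⟨⟨_, hqU⟩⟩
  exact ⟨(fromNormalizationIn φ).left ⁻¹ᵁ U, hqU, hU.preimage _,
    (sections_normalizationIn φ hφ hU).2⟩

end Normalization

end CurveCovering

/-! ### Intermediate fields and factorizations of a covering. -/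

namespace CurveCovering

open Scheme

variable {X Y : Over (Spec (CommRingCat.of ℂ))} [IsCurve X] [IsCurve Y] (π : X ⟶ Y) [IsCovering π]

theorem extensionPoint_functionFieldMap : Y.left.extensionPoint (functionFieldMap π) =
    X.left.fromSpecStalk (genericPoint X.left) ≫ π.left := by
  rw [extensionPoint, functionFieldMap, Spec.map_comp, Category.assoc,
    SpecMap_stalkSpecializes_fromSpecStalk, SpecMap_stalkMap_fromSpecStalk]

instance nonempty_preimage (U : Y.left.Opens) [Nonempty U] : Nonempty (π.left ⁻¹ᵁ U) :=
  ⟨genericPoint X.left, by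
    change π.left _ ∈ U
    rw [map_genericPoint]
    exact Y.left.genericPoint_mem_of_nonempty (Set.nonempty_coe_sort.mp ‹_›)⟩

theorem germToFunctionField_functionFieldMap (U : Y.left.Opens) [Nonempty U] :
    Y.left.germToFunctionField U ≫ functionFieldMap π =
      π.left.app U ≫ X.left.germToFunctionField (π.left ⁻¹ᵁ U) := by
  rw [functionFieldMap, ← Category.assoc, TopCat.Presheaf.germ_stalkSpecializes]
  exact Scheme.Hom.germ_stalkMap π.left U (genericPoint X.left) _

theorem functionFieldMap_algebraMap (U : Y.left.Opens) [Nonempty U] (r : Γ(Y.left, U)) :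
    functionFieldMap π (algebraMap _ Y.left.functionField r) =
      algebraMap _ X.left.functionField (π.left.app U r) :=
  congr($(germToFunctionField_functionFieldMap π U) r)

theorem finite_functionFieldMap : (functionFieldMap π).hom.Finite := by
  obtain ⟨_, ⟨U, hU, rfl⟩, hηU, -⟩ := Y.left.isBasis_affineOpens.exists_subset_of_mem_open
    (Set.mem_univ (genericPoint Y.left)) isOpen_univ
  have : Nonempty U := ⟨⟨_, hηU⟩⟩
  let _ := (functionFieldMap π).hom.toAlgebra
  let _ := (π.left.app U).hom.toAlgebra
  let _ := ((functionFieldMap π).hom.comp (algebraMap Γ(Y.left, U) Y.left.functionField)).toAlgebra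
  have : IsScalarTower Γ(Y.left, U) Y.left.functionField X.left.functionField :=
    .of_algebraMap_eq fun _ => rfl
  have : IsScalarTower Γ(Y.left, U) Γ(X.left, π.left ⁻¹ᵁ U) X.left.functionField :=
    .of_algebraMap_eq fun r => functionFieldMap_algebraMap π U r
  have := functionField_isFractionRing_of_isAffineOpen Y.left U hU
  have := functionField_isFractionRing_of_isAffineOpen X.left _ (hU.preimage π.left)
  have : Module.Finite Γ(Y.left, U) Γ(X.left, π.left ⁻¹ᵁ U) := π.left.finite_app U hU
  have := isDedekindDomain_sections hU
  have := isDedekindDomain_sections (hU.preimage π.left)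
  have : Algebra.IsAlgebraic Y.left.functionField X.left.functionField :=
    isAlgebraic_of_isFractionRing Γ(Y.left, U) Γ(X.left, π.left ⁻¹ᵁ U) _ _
  have := IsIntegralClosure.isLocalization Γ(Y.left, U) Y.left.functionField
    X.left.functionField Γ(X.left, π.left ⁻¹ᵁ U)
  exact Module.Finite.of_isLocalization Γ(Y.left, U) Γ(X.left, π.left ⁻¹ᵁ U)
    (nonZeroDivisors Γ(Y.left, U))

section Factorization

variable {F : Type} [Field F] (φ : Y.left.functionField ⟶ CommRingCat.of F)
  (ψ : CommRingCat.of F ⟶ X.left.functionField) (hφψ : φ ≫ ψ = functionFieldMap π)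

/-- `X` is the normalization of `Y` in `K(X)`: its charts over `Y` are integrally closed with
fraction field `K(X)`. -/
theorem isIso_normalizationDesc_functionFieldMap :
    IsIso ((Y.left.extensionPoint (functionFieldMap π)).normalizationDesc
      (X.left.fromSpecStalk (genericPoint X.left)) π.left (extensionPoint_functionFieldMap π)) := by
  refine isIso_normalizationDesc _ _ _ _
    (fun U hU => top_le_extensionPoint_preimage _ _ hU) fun U hU h h' => ?_
  have : Nonempty U := by
    obtain ⟨t⟩ : Nonempty (Spec X.left.functionField) := inferInstance
    exact ⟨⟨_, h (show t ∈ ⊤ from trivial)⟩⟩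
  have : Nonempty (π.left ⁻¹ᵁ U) := nonempty_preimage π U
  rw [evalPoint_extensionPoint, evalPoint_fromSpecStalk _ _
    (X.left.genericPoint_mem_of_nonempty (Set.nonempty_coe_sort.mp this))]
  refine ⟨X.left.germToFunctionField_injective (π.left ⁻¹ᵁ U), fun x hx => ?_⟩
  have := functionField_isFractionRing_of_isAffineOpen X.left _ (hU.preimage π.left)
  have := isDedekindDomain_sections (hU.preimage π.left)
  have hx' : IsIntegral Γ(X.left, π.left ⁻¹ᵁ U) x := by
    rw [germToFunctionField_functionFieldMap] at hx
    obtain ⟨p, hp, hpx⟩ := hx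
    exact ⟨p.map (π.left.app U).hom, hp.map _, by rw [Polynomial.eval₂_map]; exact hpx⟩
  exact IsIntegrallyClosed.algebraMap_eq_of_integral hx'

include hφψ in
-- With `X` seen as a normalization of `Y`, the map comes from the universal property of
-- normalization.
theorem exists_factorization_normalizationIn : ∃ f : X ⟶ normalizationIn φ,
    f ≫ fromNormalizationIn φ = π ∧
    X.left.fromSpecStalk (genericPoint X.left) ≫ f.left = Spec.map ψ ≫ toNormalizationIn φ := by
  have := isIso_normalizationDesc_functionFieldMap π
  let e := (Y.left.extensionPoint (functionFieldMap π)).normalizationDesc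
      (X.left.fromSpecStalk (genericPoint X.left)) π.left (extensionPoint_functionFieldMap π)
  have hfac : Y.left.extensionPoint (functionFieldMap π) =
      (Spec.map ψ ≫ toNormalizationIn φ) ≫ (fromNormalizationIn φ).left := by
    rw [Category.assoc, toNormalizationIn_comp, ← hφψ, extensionPoint, extensionPoint,
      Spec.map_comp, Category.assoc]
  let f : X.left ⟶ (normalizationIn φ).left := inv e ≫
    (Y.left.extensionPoint (functionFieldMap π)).normalizationDesc
      (Spec.map ψ ≫ toNormalizationIn φ) (fromNormalizationIn φ).left hfac
  have hf : f ≫ (fromNormalizationIn φ).left = π.left := by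
    rw [Category.assoc, Scheme.Hom.normalizationDesc_comp, IsIso.inv_comp_eq,
      Scheme.Hom.normalizationDesc_comp]
  refine ⟨Over.homMk f ?_, Over.OverMorphism.ext hf, ?_⟩
  · rw [← Over.w (fromNormalizationIn φ), reassoc_of% hf, Over.w]
  · change _ ≫ inv e ≫ _ = _
    rw [← Scheme.Hom.toNormalization_normalizationDesc _ _ π.left
      (extensionPoint_functionFieldMap π), Category.assoc, IsIso.hom_inv_id_assoc,
      Scheme.Hom.toNormalization_normalizationDesc]

theorem surjective_of_isIso_factorization (f : X ⟶ normalizationIn φ) [IsIso f]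
    (hf : X.left.fromSpecStalk (genericPoint X.left) ≫ f.left =
      Spec.map ψ ≫ toNormalizationIn φ) : Function.Surjective ψ := by
  have : IsIso f.left := inferInstanceAs (IsIso ((Over.forget _).map f))
  obtain ⟨_, ⟨U, hU, rfl⟩, hηU, -⟩ := Y.left.isBasis_affineOpens.exists_subset_of_mem_open
    (Set.mem_univ (genericPoint Y.left)) isOpen_univ
  have : Nonempty U := ⟨⟨_, hηU⟩⟩
  let W := f.left ⁻¹ᵁ ((fromNormalizationIn φ).left ⁻¹ᵁ U)
  have hW : IsAffineOpen W := (hU.preimage _).preimage _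
  have hηW : genericPoint X.left ∈ W := by
    have h := top_le_toNormalizationIn_preimage φ (U := U)
    obtain ⟨t⟩ : Nonempty (Spec X.left.functionField) := inferInstance
    have ht : X.left.fromSpecStalk (genericPoint X.left) t ∈ W := by
      change (X.left.fromSpecStalk (genericPoint X.left) ≫ f.left) t ∈
        (fromNormalizationIn φ).left ⁻¹ᵁ U
      rw [hf]
      exact h trivial
    exact X.left.genericPoint_mem_of_nonempty ⟨_, ht⟩
  have : Nonempty W := ⟨⟨_, hηW⟩⟩
  have hfac := appLE_evalPoint (X.left.fromSpecStalk (genericPoint X.left)) f.left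
    ((fromNormalizationIn φ).left ⁻¹ᵁ U) W le_rfl (X.left.top_le_fromSpecStalk_preimage _ hηW)
  simp only [hf] at hfac
  rw [evalPoint_specMap_comp _ _ _ (top_le_toNormalizationIn_preimage φ),
    evalPoint_fromSpecStalk _ _ hηW, ← Scheme.Hom.app_eq_appLE] at hfac
  have hrange : ∀ s : Γ(X.left, W), algebraMap _ X.left.functionField s ∈ Set.range ψ := by
    intro s
    obtain ⟨b, rfl⟩ := (ConcreteCategory.bijective_of_isIso
      (f.left.app ((fromNormalizationIn φ).left ⁻¹ᵁ U))).2 s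
    exact ⟨_, congr($hfac.symm b)⟩
  have := functionField_isFractionRing_of_isAffineOpen X.left W hW
  intro x
  obtain ⟨s, t, -, rfl⟩ := IsFractionRing.div_surjective Γ(X.left, W) x
  obtain ⟨a, ha⟩ := hrange s
  obtain ⟨b, hb⟩ := hrange t
  exact ⟨(a / b : F), by rw [← ha, ← hb]; exact map_div₀ ψ.hom a b⟩

/-- Clearing denominators makes an element of `F` integral over a chart of `Y`; if the normalization
adds nothing, the result already comes from that chart. -/
theorem surjective_of_isIso_fromNormalizationIn (hφ : φ.hom.Finite)
    [IsIso (fromNormalizationIn φ)] : Function.Surjective φ := by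
  have : IsIso (fromNormalizationIn φ).left :=
    inferInstanceAs (IsIso ((Over.forget _).map (fromNormalizationIn φ)))
  obtain ⟨_, ⟨U, hU, rfl⟩, hηU, -⟩ := Y.left.isBasis_affineOpens.exists_subset_of_mem_open
    (Set.mem_univ (genericPoint Y.left)) isOpen_univ
  have : Nonempty U := ⟨⟨_, hηU⟩⟩
  let _ := φ.hom.toAlgebra
  let _ := (φ.hom.comp (algebraMap Γ(Y.left, U) Y.left.functionField)).toAlgebra
  have : FiniteDimensional Y.left.functionField F := hφ
  have : IsScalarTower Γ(Y.left, U) Y.left.functionField F := .of_algebraMap_eq fun _ => rfl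
  have := functionField_isFractionRing_of_isAffineOpen Y.left U hU
  intro x
  obtain ⟨m, hm⟩ := IsIntegral.exists_multiple_integral_of_isLocalization
    (nonZeroDivisors Γ(Y.left, U)) (Rₘ := Y.left.functionField) (x : F)
    (Algebra.IsIntegral.isIntegral x)
  obtain ⟨b, hb⟩ := (isIntegralElem_iff_mem_range_normalizationInEval φ hU _).mp hm
  obtain ⟨r, rfl⟩ := (ConcreteCategory.bijective_of_isIso
    ((fromNormalizationIn φ).left.app U)).2 b
  rw [normalizationInEval_app] at hb
  have hm0 : algebraMap Γ(Y.left, U) Y.left.functionField m ≠ 0 :=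
    IsLocalization.to_map_ne_zero_of_mem_nonZeroDivisors _ le_rfl m.2
  refine ⟨algebraMap Γ(Y.left, U) Y.left.functionField r /
    algebraMap Γ(Y.left, U) Y.left.functionField m, ?_⟩
  refine (map_div₀ φ.hom _ _).trans ?_
  rw [div_eq_iff ((map_ne_zero φ.hom).mpr hm0)]
  refine hb.trans ?_
  rw [Submonoid.smul_def, Algebra.smul_def, mul_comm]
  rfl

end Factorization

theorem IsPrimitive.eq_bot_or_eq_top (hπ : IsPrimitive π) :
    letI := functionFieldAlgebra π
    ∀ F : IntermediateField Y.left.functionField X.left.functionField, F = ⊥ ∨ F = ⊤ := by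
  let _ := functionFieldAlgebra π
  intro F
  let φ : Y.left.functionField ⟶ CommRingCat.of F := CommRingCat.ofHom
    (R := Y.left.functionField) (S := F) (algebraMap Y.left.functionField F)
  let ψ : CommRingCat.of F ⟶ X.left.functionField := CommRingCat.ofHom
    (R := F) (S := X.left.functionField) (algebraMap F X.left.functionField)
  have : FiniteDimensional Y.left.functionField X.left.functionField := finite_functionFieldMap π
  have hφ : φ.hom.Finite := inferInstanceAs (FiniteDimensional Y.left.functionField F)
  have := isCurve_normalizationIn φ hφ
  obtain ⟨f, hf, hf'⟩ := exists_factorization_normalizationIn π φ ψ rfl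
  rcases hπ _ f (fromNormalizationIn φ) hf with h | h
  · right
    refine eq_top_iff.mpr fun x _ => ?_
    obtain ⟨y, rfl⟩ := surjective_of_isIso_factorization φ ψ f hf' x
    exact y.2
  · left
    refine eq_bot_iff.mpr fun x hx => ?_
    obtain ⟨y, hy⟩ := surjective_of_isIso_fromNormalizationIn φ hφ ⟨x, hx⟩
    exact IntermediateField.mem_bot.mpr ⟨y, congrArg Subtype.val hy⟩

end CurveCovering

/-! ### Ramification indices under localization. -/

section Localization

theorem Ideal.ramificationIdx_maximalIdeal_eq_one (R : Type*) {T : Type*} [CommRing R] [CommRing T]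
    [Algebra R T] [IsLocalRing T] [Algebra.FormallyUnramified R T] [Algebra.EssFiniteType R T] :
    (IsLocalRing.maximalIdeal T).ramificationIdx R = 1 :=
  Ideal.ramificationIdx_eq_one _ R

/-- The index of `Sq` over `R` is multiplicative through `S` and through `Rp`; in each tower the
localization is unramified and contributes `1`. -/
theorem Ideal.ramificationIdx_maximalIdeal_eq {R S Rp Sq : Type*} [CommRing R] [CommRing S]
    [CommRing Rp] [CommRing Sq] [Algebra R S] [Algebra R Rp] [Algebra R Sq] [Algebra S Sq]
    [Algebra Rp Sq] [IsScalarTower R S Sq] [IsScalarTower R Rp Sq] [IsLocalRing Rp]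
    [IsLocalRing Sq] (p : Ideal R) [p.IsPrime] (q : Ideal S) [q.IsPrime]
    [IsLocalization.AtPrime Rp p] [IsLocalization.AtPrime Sq q] [IsLocalHom (algebraMap Rp Sq)]
    [Module.Flat Rp Sq] :
    (IsLocalRing.maximalIdeal Sq).ramificationIdx Rp = q.ramificationIdx R := by
  have : Module.Flat S Sq := IsLocalization.flat Sq q.primeCompl
  have : Algebra.FormallyUnramified R Rp := .of_isLocalization p.primeCompl
  have : Algebra.FormallyUnramified S Sq := .of_isLocalization q.primeCompl
  have : Algebra.EssFiniteType R Rp := .of_isLocalization Rp p.primeCompl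
  have : Algebra.EssFiniteType S Sq := .of_isLocalization Sq q.primeCompl
  have : (IsLocalRing.maximalIdeal Sq).LiesOver q :=
    ⟨(IsLocalization.AtPrime.under_maximalIdeal Sq q).symm⟩
  have h1 := Ideal.ramificationIdx_tower (R := R) q (IsLocalRing.maximalIdeal Sq)
  have h2 := Ideal.ramificationIdx_tower (R := R) (IsLocalRing.maximalIdeal Rp)
    (IsLocalRing.maximalIdeal Sq)
  rw [Ideal.ramificationIdx_maximalIdeal_eq_one S, mul_one] at h1
  rw [Ideal.ramificationIdx_maximalIdeal_eq_one R (T := Rp), one_mul] at h2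
  rw [← h1, ← h2]

end Localization

/-! ### Fibres of a covering as sets of primes. -/

namespace CurveCovering

open Scheme

variable {X Y : Over (Spec (CommRingCat.of ℂ))} [IsCurve X] [IsCurve Y] (π : X ⟶ Y) [IsCovering π]
  {U : Y.left.Opens} (hU : IsAffineOpen U)

theorem app_injective (U : Y.left.Opens) [Nonempty U] : Function.Injective (π.left.app U) := by
  have h : Function.Injective (Y.left.germToFunctionField U ≫ functionFieldMap π) :=
    (RingHom.injective (R := Y.left.functionField) (functionFieldMap π).hom).comp
      (Y.left.germToFunctionField_injective U)
  rw [germToFunctionField_functionFieldMap] at h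
  exact fun a b hab => h (by simp [hab])

include hU in
theorem ramificationIndex_eq (x : X.left) (hx : x ∈ π.left ⁻¹ᵁ U) :
    letI := (π.left.app U).hom.toAlgebra
    ramificationIndex π x =
      ((hU.preimage π.left).primeIdealOf ⟨x, hx⟩).asIdeal.ramificationIdx Γ(Y.left, U) := by
  have : Nonempty U := ⟨⟨_, hx⟩⟩
  have := isDedekindDomain_sections hU
  let _ := (π.left.app U).hom.toAlgebra
  let _ := (π.left.stalkMap x).hom.toAlgebra
  let _ := (Y.left.presheaf.germ U (π.left x) hx).hom.toAlgebra
  let _ := (X.left.presheaf.germ (π.left ⁻¹ᵁ U) x hx).hom.toAlgebra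
  let _ := (π.left.app U ≫ X.left.presheaf.germ (π.left ⁻¹ᵁ U) x hx).hom.toAlgebra
  have h1 : IsLocalization.AtPrime (Y.left.presheaf.stalk (π.left x))
      (hU.primeIdealOf ⟨π.left x, hx⟩).asIdeal := hU.isLocalization_stalk ⟨π.left x, hx⟩
  have h2 : IsLocalization.AtPrime (X.left.presheaf.stalk x)
      ((hU.preimage π.left).primeIdealOf ⟨x, hx⟩).asIdeal :=
    (hU.preimage π.left).isLocalization_stalk ⟨x, hx⟩
  have : IsScalarTower Γ(Y.left, U) Γ(X.left, π.left ⁻¹ᵁ U) (X.left.presheaf.stalk x) :=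
    .of_algebraMap_eq fun _ => rfl
  have : IsScalarTower Γ(Y.left, U) (Y.left.presheaf.stalk (π.left x))
      (X.left.presheaf.stalk x) :=
    .of_algebraMap_eq fun r => congr($((π.left.germ_stalkMap U x hx).symm) r)
  have : IsLocalHom (algebraMap (Y.left.presheaf.stalk (π.left x)) (X.left.presheaf.stalk x)) :=
    inferInstanceAs (IsLocalHom (π.left.stalkMap x).hom)
  have hinj : Function.Injective (algebraMap Γ(Y.left, U) (X.left.presheaf.stalk x)) :=
    (germ_injective_of_isIntegral X.left x hx).comp (app_injective π U)
  have : Module.IsTorsionFree Γ(Y.left, U) (X.left.presheaf.stalk x) := by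
    have := (faithfulSMul_iff_algebraMap_injective Γ(Y.left, U) (X.left.presheaf.stalk x)).mpr hinj
    infer_instance
  have : Module.Flat (Y.left.presheaf.stalk (π.left x)) (X.left.presheaf.stalk x) :=
    (Module.flat_iff_of_isLocalization _ (hU.primeIdealOf ⟨π.left x, hx⟩).asIdeal.primeCompl _).mpr
      inferInstance
  exact Ideal.ramificationIdx_maximalIdeal_eq (hU.primeIdealOf ⟨π.left x, hx⟩).asIdeal _

/-- The points of the fibre of a covering are the primes over the corresponding prime. -/
noncomputable def fibreEquivPrimesOver (y : Y.left) (hy : y ∈ U) :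
    letI := (π.left.app U).hom.toAlgebra
    {x : X.left // π.left x = y} ≃
      (hU.primeIdealOf ⟨y, hy⟩).asIdeal.primesOver Γ(X.left, π.left ⁻¹ᵁ U) :=
  letI := (π.left.app U).hom.toAlgebra
  have hcomap (x : X.left) (hx : x ∈ π.left ⁻¹ᵁ U) :
      ((hU.preimage π.left).primeIdealOf ⟨x, hx⟩).asIdeal.under Γ(Y.left, U) =
        (hU.primeIdealOf ⟨π.left x, hx⟩).asIdeal := by
    rw [← IsAffineOpen.comap_primeIdealOf_appLE U hU _ (hU.preimage π.left) le_rfl hx,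
      ← Scheme.Hom.app_eq_appLE]
    rfl
  Equiv.ofBijective (fun x => ⟨((hU.preimage π.left).primeIdealOf
      ⟨x.1, by
        change π.left x.1 ∈ U
        rw [x.2]
        exact hy⟩).asIdeal,
    ((hU.preimage π.left).primeIdealOf _).2, ⟨by
      rw [hcomap]
      congr 2
      exact Subtype.ext x.2.symm⟩⟩) (by
    constructor
    · intro x x' h
      have h' := congrArg Subtype.val ((hU.preimage π.left).isoSpec.hom.homeomorph.injective
        (PrimeSpectrum.ext (congrArg Subtype.val h)))
      exact Subtype.ext h'
    · rintro ⟨P, hP, hPy⟩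
      obtain ⟨⟨x, hx⟩, hxP⟩ := (hU.preimage π.left).isoSpec.hom.homeomorph.surjective
        (⟨P, hP⟩ : PrimeSpectrum _)
      have hxP' : ((hU.preimage π.left).primeIdealOf ⟨x, hx⟩).asIdeal = P :=
        congrArg PrimeSpectrum.asIdeal hxP
      have hxy : π.left x = y := by
        have h := hcomap x hx
        rw [hxP', ← hPy.over] at h
        exact (congrArg Subtype.val (hU.isoSpec.hom.homeomorph.injective
          (PrimeSpectrum.ext h))).symm
      exact ⟨⟨x, hxy⟩, Subtype.ext hxP'⟩)

theorem ramificationIndex_eq_fibreEquivPrimesOver (y : Y.left) (hy : y ∈ U)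
    (x : {x : X.left // π.left x = y}) :
    letI := (π.left.app U).hom.toAlgebra
    ramificationIndex π x.1 = (fibreEquivPrimesOver π hU y hy x).1.ramificationIdx Γ(Y.left, U) :=
  ramificationIndex_eq π hU x.1 _

end CurveCovering

/-! ### The bounds for extensions of fields. -/

section FunctionField

universe u

/-- The degree of a finite extension of fields without intermediate fields whose Galois closure is
solvable, and the contribution of a ramified prime to its branch divisor. -/
theorem exists_finrank_eq_prime_pow_and_le_finsum_ramificationIdx (F : Type*) [Field F]
    [IsAlgClosed F] {K L : Type u} [Field K] [Field L] [CharZero K] [Algebra K L]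
    [FiniteDimensional K L] (h : ∀ E : IntermediateField K L, E = ⊥ ∨ E = ⊤)
    (hs : Group.IsSolvable Gal(IntermediateField.normalClosure K L (AlgebraicClosure L)/K)) :
    ∃ p n : ℕ, p.Prime ∧ Module.finrank K L = p ^ n ∧
      ∀ (R S : Type u) [CommRing R] [CommRing S] [Algebra F R] [Algebra F S] [Algebra R S]
        [IsScalarTower F R S] [Algebra.FiniteType F R] [Algebra.FiniteType F S] [Algebra R K]
        [Algebra S L] [Algebra R L] [IsScalarTower R S L] [IsScalarTower R K L]
        [IsFractionRing R K] [IsFractionRing S L] [IsDedekindDomain R] [IsIntegrallyClosed S]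
        [Module.Finite R S] [Module.IsTorsionFree R S] (I : Ideal R) [I.IsMaximal],
        (∃ q : I.primesOver S, 1 < q.1.ramificationIdx R) →
        p ^ n ≤ 2 * (∑ᶠ q : I.primesOver S, (q.1.ramificationIdx R - 1)) + p ^ (n - 1) ∧
        (p = 2 → (p ^ n - 1).Prime →
          2 ^ n ≤ 2 * (∑ᶠ q : I.primesOver S, (q.1.ramificationIdx R - 1)) + 2) := by
  have : Algebra.IsAlgebraic K (AlgebraicClosure L) := Algebra.IsAlgebraic.trans _ L _
  have : IsAlgClosure K (AlgebraicClosure L) := ⟨inferInstance, inferInstance⟩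
  have : Normal K (AlgebraicClosure L) := IsAlgClosure.normal _ _
  have : Nonempty (L →ₐ[K] AlgebraicClosure L) := ⟨IsScalarTower.toAlgHom _ _ _⟩
  have : IsGalois K (IntermediateField.normalClosure K L (AlgebraicClosure L)) := { }
  obtain ⟨p, n, hp, hdeg, hD⟩ := IsGalois.exists_finrank_eq_prime_pow_and_card_orbits_le
    (N := IntermediateField.normalClosure K L (AlgebraicClosure L)) h hs
  refine ⟨p, n, hp, hdeg, ?_⟩
  intro R S _ _ _ _ _ _ _ _ _ _ _ _ _ _ _ _ _ _ _ I _ hI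
  let N := IntermediateField.normalClosure K L (AlgebraicClosure L)
  let _ : Algebra R N := ((algebraMap K N).comp (algebraMap R K)).toAlgebra
  let _ : Algebra S N := ((algebraMap L N).comp (algebraMap S L)).toAlgebra
  have : IsScalarTower R K N := .of_algebraMap_eq fun _ => rfl
  have : IsScalarTower S L N := .of_algebraMap_eq fun _ => rfl
  have : IsScalarTower R S N := .of_algebraMap_eq fun r => by
    change algebraMap K N (algebraMap R K r) = algebraMap L N (algebraMap S L (algebraMap R S r))
    rw [← IsScalarTower.algebraMap_apply R S L, IsScalarTower.algebraMap_apply R K L,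
      ← IsScalarTower.algebraMap_apply K L N]
  -- Here `m` bounds the fixed points: `p ^ (n - 1)` in general, `2` in the Mersenne case.
  have key (m : ℕ) := Ideal.finrank_le_two_mul_finsum_ramificationIdx_sub_one F (S := S) (K := K)
    (L := L) (N := N) I m
  refine ⟨hdeg ▸ key _ (fun D hD' => hdeg ▸ (hD D hD').1) hI, fun hp2 hpn => ?_⟩
  subst hp2
  rw [← hdeg]
  exact key 2 (fun D hD' => hdeg ▸ (hD D hD').2 rfl hpn) hI

end FunctionField

/-! ### The bounds for coverings of curves. -/

namespace CurveCovering

section Branch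

variable {X Y : Over (Spec (CommRingCat.of ℂ))} [IsCurve X] [IsCurve Y] (π : X ⟶ Y) [IsCovering π]

theorem exists_degree_eq_prime_pow_and_le_branchMultiplicity (hprim : IsPrimitive π)
    (hsolv : IsSolvableCovering π) : ∃ p k : ℕ, p.Prime ∧ degree π = p ^ k ∧
      ∀ y : Y.left, IsBranchPoint π y → p ^ k ≤ 2 * branchMultiplicity π y + p ^ (k - 1) ∧
        (p = 2 → (p ^ k - 1).Prime → 2 ^ k ≤ 2 * branchMultiplicity π y + 2) := by
  let _ := functionFieldAlgebra π
  have : FiniteDimensional Y.left.functionField X.left.functionField := finite_functionFieldMap π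
  obtain ⟨p, k, hp, hdeg, h⟩ := exists_finrank_eq_prime_pow_and_le_finsum_ramificationIdx ℂ
    (IsPrimitive.eq_bot_or_eq_top π hprim) hsolv
  refine ⟨p, k, hp, hdeg, fun y ⟨hyc, hyb⟩ => ?_⟩
  obtain ⟨_, ⟨U, hU, rfl⟩, hyU, -⟩ := Y.left.isBasis_affineOpens.exists_subset_of_mem_open
    (Set.mem_univ y) isOpen_univ
  have : Nonempty U := ⟨⟨_, hyU⟩⟩
  let _ := (π.left.app U).hom.toAlgebra
  let _ := ((algebraMap Y.left.functionField X.left.functionField).comp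
    (algebraMap Γ(Y.left, U) Y.left.functionField)).toAlgebra
  have hm := hU.primeIdealOf_isMaximal_of_isClosed ⟨y, hyU⟩ hyc
  have h1 : IsScalarTower Γ(Y.left, U) Y.left.functionField X.left.functionField :=
    .of_algebraMap_eq fun _ => rfl
  have h4 : IsScalarTower Γ(Y.left, U) Γ(X.left, π.left ⁻¹ᵁ U) X.left.functionField :=
    .of_algebraMap_eq fun r => functionFieldMap_algebraMap π U r
  have h6 : IsScalarTower ℂ Γ(Y.left, U) Γ(X.left, π.left ⁻¹ᵁ U) := .of_algebraMap_eq fun c => by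
    rw [← algebraMap_sections_appLE π U _ le_rfl, ← Scheme.Hom.app_eq_appLE]
    rfl
  have := finiteType_sections Y hU
  have := finiteType_sections X (hU.preimage π.left)
  have := functionField_isFractionRing_of_isAffineOpen Y.left U hU
  have := functionField_isFractionRing_of_isAffineOpen X.left _ (hU.preimage π.left)
  have := isDedekindDomain_sections hU
  have := isDedekindDomain_sections (hU.preimage π.left)
  have : Module.Finite Γ(Y.left, U) Γ(X.left, π.left ⁻¹ᵁ U) := π.left.finite_app U hU
  have : Module.IsTorsionFree Γ(Y.left, U) Γ(X.left, π.left ⁻¹ᵁ U) := by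
    have := (faithfulSMul_iff_algebraMap_injective Γ(Y.left, U)
      Γ(X.left, π.left ⁻¹ᵁ U)).mpr (app_injective π U)
    infer_instance
  let e := fibreEquivPrimesOver π hU y hyU
  have he : ∀ x, ramificationIndex π x.1 = (e x).1.ramificationIdx Γ(Y.left, U) :=
    ramificationIndex_eq_fibreEquivPrimesOver π hU y hyU
  have hb : branchMultiplicity π y = ∑ᶠ q : (hU.primeIdealOf ⟨y, hyU⟩).asIdeal.primesOver
      Γ(X.left, π.left ⁻¹ᵁ U), (q.1.ramificationIdx Γ(Y.left, U) - 1) := by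
    rw [branchMultiplicity, ← finsum_comp_equiv e]
    exact finsum_congr fun x => by rw [he]
  have hram : ∃ q : (hU.primeIdealOf ⟨y, hyU⟩).asIdeal.primesOver Γ(X.left, π.left ⁻¹ᵁ U),
      1 < q.1.ramificationIdx Γ(Y.left, U) := by
    obtain ⟨x, hx, hx'⟩ := hyb
    exact ⟨e ⟨x, hx⟩, by rw [← he]; exact hx'⟩
  rw [hb]
  exact h _ _ _ hram

end Branch

end CurveCovering

theorem mainTheorem3 (X Y : CategoryTheory.Over (AlgebraicGeometry.Spec (CommRingCat.of ℂ)))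
    [CurveCovering.IsCurve X] [CurveCovering.IsCurve Y]
    (π : X ⟶ Y) [CurveCovering.IsCovering π]
    (hprim : CurveCovering.IsPrimitive π) (hsolv : CurveCovering.IsSolvableCovering π) :
    ∃ p k : ℕ, p.Prime ∧ CurveCovering.degree π = p ^ k ∧
      ∀ y : Y.left, CurveCovering.IsBranchPoint π y →
        ((p : ℝ) ^ k - (p : ℝ) ^ (k - 1)) / 2 ≤ (CurveCovering.branchMultiplicity π y : ℝ) ∧
        (p = 2 → (CurveCovering.degree π - 1).Prime →
          (2 : ℝ) ^ (k - 1) - 1 ≤ (CurveCovering.branchMultiplicity π y : ℝ)) := by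
  obtain ⟨p, k, hp, hdeg, h⟩ :=
    CurveCovering.exists_degree_eq_prime_pow_and_le_branchMultiplicity π hprim hsolv
  refine ⟨p, k, hp, hdeg, fun y hy => ⟨?_, fun hp2 hprime => ?_⟩⟩
  · have h1 : ((p ^ k : ℕ) : ℝ) ≤
        ((2 * CurveCovering.branchMultiplicity π y + p ^ (k - 1) : ℕ) : ℝ) :=
      Nat.cast_le.mpr (h y hy).1
    push_cast at h1
    linarith
  · rw [hdeg] at hprime
    -- Needed to split `2 ^ k` as twice `2 ^ (k - 1)`; for `k = 0` the number `d - 1` would be `0`.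
    have hk : k ≠ 0 := by
      rintro rfl
      simp [Nat.not_prime_zero] at hprime
    have h1 : ((2 ^ k : ℕ) : ℝ) ≤ ((2 * CurveCovering.branchMultiplicity π y + 2 : ℕ) : ℝ) :=
      Nat.cast_le.mpr ((h y hy).2 hp2 hprime)
    push_cast at h1
    rw [← pow_sub_one_mul hk] at h1
    linarith
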